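/- Let $m,n$ be positive integers, let $R=(r_1,\dots,r_m)\in\mathbb Z_{\ge0}^m$ and $C=(c_1,\dots,c_n)\in\mathbb Z_{\ge0}^n$ satisfy $\sum_i r_i=\sum_j c_j=N$, and let $\kappa\in\mathbb Z_{>0}\cup\{\infty\}$. For $\kappa=\infty$, read $\{0,1,\dots,\kappa\}$ as $\mathbb Z_{\ge0}$ and $[0,\kappa]$ as $[0,\infty)$. Let $\Pi_\kappa(R,C)$ be the set of real $m\times n$ matrices $Z=(z_{ij})$ with entries in $[0,\kappa]$, row sums $\sum_j z_{ij}=r_i$ and column sums $\sum_i z_{ij}=c_j$; let $T_\kappa(R,C)$ be the number of integer points of $\Pi_\kappa(R,C)$. For $s\ge 1$ let $R^{(s)}\in\mathbb Z_{\ge0}^{sm}$ be the concatenation of $s$ copies of $(sr_1,\dots,sr_m)$, and $C^{(s)}\in\mathbb Z_{\ge0}^{sn}$ the concatenation of $s$ copies of $(sc_1,\dots,sc_n)$. A distribution on $\{0,1,\dots,\kappa\}$ is called truncated geometric if there are $p\in(0,1]$ and $q\in[0,\infty)$ with $\Pr[t]=pq^t$ for all $t\in\{0,1,\dots,\kappa\}$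 (with $0^0=1$), or if $\kappa<\infty$ and it is the point mass at $\kappa$. For each $x\in[0,\kappa]$ there is exactly one truncated geometric distribution with mean $x$; let $H^{\max}_\kappa(x)=-\sum_t\Pr[t]\ln\Pr[t]$ denote its entropy (with $0\ln 0=0$). Let $\binom{n}{r}_\kappa$ be the coefficient of $x^r$ in $(1+x+x^2+\cdots+x^\kappa)^n$ (a power of the series $\sum_{t\ge0}x^t$ if $\kappa=\infty$). The independence heuristic is $$I_\kappa(R,C)=\binom{mn}{N}_\kappa^{-1}\prod_{i=1}^m\binom{n}{r_i}_\kappa\prod_{j=1}^n\binom{m}{c_j}_\kappa,$$ and $I_\kappa(R^{(s)},C^{(s)})$ is given by the same formula with $m,n,N$ replaced by $sm,sn,s^2N$. Assume that $T_\kappa(R,C)>0$. Then: (i) the maximum below is attained, the limit exists, and $$\lim_{s\to\infty}\frac1{s^2}\ln T_\kappa(R^{(s)},C^{(s)})=\max_{Z\in\Pi_\kappa(R,C)}\sum_{i=1}^m\sum_{j=1}^n H^{\max}_\kappa(z_{ij});$$ (ii) the limit below exists, and $$\lim_{s\to\infty}\frac1{s^2}\ln I_\kappa(R^{(s)},C^{(s)})=-mn\,H^{\max}_\kappa\!\left(\frac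 N{mn}\right)+n\sum_{i=1}^m H^{\max}_\kappa\!\left(\frac{r_i}n\right)+m\sum_{j=1}^n H^{\max}_\kappa\!\left(\frac{c_j}m\right).$$ -/

import Mathlib

open Filter Topology

noncomputable section

namespace CTable

/-! ### Contingency tables and the transportation polytope -/

/-- The truncated transportation polytope `Π_κ(R,C)`: the real `m × n` matrices with entries in
`[0, κ]` (in `[0, ∞)` when `κ = ⊤`), row sums `R` and column sums `C`. -/
def polytope {m n : ℕ} (κ : ℕ∞) (R : Fin m → ℕ) (C : Fin n → ℕ) :
    Set (Matrix (Fin m) (Fin n) ℝ) :=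
  {Z | (∀ i j, 0 ≤ Z i j) ∧ (∀ k : ℕ, κ = k → ∀ i j, Z i j ≤ k) ∧
    (∀ i, ∑ j, Z i j = R i) ∧ (∀ j, ∑ i, Z i j = C j)}

/-- The contingency tables with margins `R`, `C` and entries in `{0, 1, …, κ}`. -/
def tables {m n : ℕ} (κ : ℕ∞) (R : Fin m → ℕ) (C : Fin n → ℕ) :
    Set (Matrix (Fin m) (Fin n) ℕ) :=
  {A | (∀ i j, (A i j : ℕ∞) ≤ κ) ∧ (∀ i, ∑ j, A i j = R i) ∧ (∀ j, ∑ i, A i j = C j)}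

/-- Contingency tables are the integer points of the polytope. -/
theorem mem_tables_iff {m n : ℕ} (κ : ℕ∞) (R : Fin m → ℕ) (C : Fin n → ℕ)
    (A : Matrix (Fin m) (Fin n) ℕ) :
    A ∈ tables κ R C ↔ A.map (fun a : ℕ => (a : ℝ)) ∈ polytope κ R C := by
  have e : (∀ i j, (A i j : ℕ∞) ≤ κ) ↔ ∀ k : ℕ, κ = k → ∀ i j, (A i j : ℝ) ≤ k := by
    induction κ using ENat.recTopCoe with
    | top => simp
    | coe k => simp
  simp only [tables, polytope, Set.mem_ofPred_eq, Matrix.map_apply, e]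
  norm_cast
  simp

/-- There are only finitely many tables with given margins, so that counting them with
`Set.ncard` is meaningful. -/
theorem finite_tables {m n : ℕ} (κ : ℕ∞) (R : Fin m → ℕ) (C : Fin n → ℕ) :
    (tables κ R C).Finite := by
  refine (Set.Finite.pi' (fun i : Fin m => Set.Finite.pi' (fun _ : Fin n =>
    Set.finite_Iic (R i)))).subset ?_
  intro A hA i j
  rw [Set.mem_Iic, ← hA.2.1 i]
  exact Finset.single_le_sum (f := fun j => A i j) (fun _ _ => Nat.zero_le _) (Finset.mem_univ j)

/-- `T_κ(R,C)`, the number of contingency tables. -/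
def numTables {m n : ℕ} (κ : ℕ∞) (R : Fin m → ℕ) (C : Fin n → ℕ) : ℕ :=
  (tables κ R C).ncard

/-- The `s`-fold cloning of a vector: `s` consecutive copies of `(s r₁, …, s r_m)`. -/
def clone {m : ℕ} (s : ℕ) (R : Fin m → ℕ) : Fin (s * m) → ℕ :=
  fun i => s * R i.modNat

/-! ### Truncated geometric distributions and their entropy -/

/-- `μ` is truncated geometric with support `{0, 1, …, κ}`: either `Pr[t] = p q ^ t` on the support
with `p ∈ (0,1]` and `q ∈ [0,∞)`, or (`κ` finite; parameters `p = 0`, `q = ∞`) `μ` is the point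
mass at `κ`. For `κ = ⊤` the total mass being `1` forces `q < 1`. -/
def IsTruncatedGeometric (κ : ℕ∞) (μ : PMF ℕ) : Prop :=
  (∃ p q : ℝ, 0 < p ∧ p ≤ 1 ∧ 0 ≤ q ∧
      (∀ t : ℕ, (t : ℕ∞) ≤ κ → (μ t).toReal = p * q ^ t) ∧
      (∀ t : ℕ, κ < (t : ℕ∞) → μ t = 0)) ∨
    ∃ k : ℕ, κ = k ∧ μ = PMF.pure k

/-- `μ` has expected value `x`. -/
def HasMean (μ : PMF ℕ) (x : ℝ) : Prop :=
  HasSum (fun t : ℕ => (t : ℝ) * (μ t).toReal) x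

/-- Shannon entropy to base `e`: `-∑ Pr[t] ln Pr[t]`. -/
def entropy (μ : PMF ℕ) : ℝ :=
  ∑' t : ℕ, -((μ t).toReal * Real.log (μ t).toReal)

open Classical in
/-- `TG(x;κ)`: the truncated geometric distribution with support `{0, 1, …, κ}` and expected
value `x`. It exists and is unique for `x ∈ [0, κ]`; outside this domain the value is
irrelevant. -/
def TG (κ : ℕ∞) (x : ℝ) : PMF ℕ :=
  if h : ∃ μ, IsTruncatedGeometric κ μ ∧ HasMean μ x then h.choose else PMF.pure 0

theorem hasSum_toReal (μ : PMF ℕ) : HasSum (fun t => (μ t).toReal) 1 := by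
  have h := (ENNReal.summable_toReal (μ.tsum_coe ▸ ENNReal.one_ne_top)).hasSum
  rwa [← ENNReal.tsum_toReal_eq (fun t => μ.apply_ne_top t), μ.tsum_coe, ENNReal.toReal_one] at h

theorem pmf_ext_toReal {μ ν : PMF ℕ} (h : ∀ t, (μ t).toReal = (ν t).toReal) : μ = ν :=
  PMF.ext fun t => (ENNReal.toReal_eq_toReal_iff' (μ.apply_ne_top t) (ν.apply_ne_top t)).1 (h t)

/-- A distribution whose mean is an endpoint `k` of its range is the point mass at `k`. -/
theorem eq_pure_of_mean {μ : PMF ℕ} {k : ℕ} (hm : HasMean μ k)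
    (hs : (∀ t, μ t ≠ 0 → t ≤ k) ∨ k = 0) : μ = PMF.pure k := by
  have h1 := hm.sub ((hasSum_toReal μ).mul_left (k : ℝ))
  simp only [mul_one, sub_self] at h1
  have key : ∀ t, t ≠ k → μ t = 0 := by
    rcases hs with hs | rfl
    · have h2 := (hasSum_zero_iff_of_nonneg (f := fun t : ℕ => -((t : ℝ) * (μ t).toReal
        - k * (μ t).toReal)) (fun t => ?_)).1 (by simpa using h1.neg)
      · intro t ht
        have h3 := congrFun h2 t
        by_contra h0
        have h4 : (t : ℝ) ≠ k := by exact_mod_cast ht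
        have h5 : (μ t).toReal ≠ 0 := (ENNReal.toReal_pos h0 (μ.apply_ne_top t)).ne'
        have h6 : ((k : ℝ) - t) * (μ t).toReal = 0 := by
          simp only [Pi.zero_apply] at h3; linarith
        rcases mul_eq_zero.1 h6 with h | h
        · exact h4 (by linarith)
        · exact h5 h
      · by_cases h0 : μ t = 0
        · simp [h0]
        · have : (t : ℝ) ≤ k := by exact_mod_cast hs t h0
          have := mul_nonneg (sub_nonneg.2 this) (ENNReal.toReal_nonneg (a := μ t))
          change (0 : ℝ) ≤ _
          linarith
    · have h2 := (hasSum_zero_iff_of_nonneg (f := fun t : ℕ => (t : ℝ) * (μ t).toReal)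
        (fun t => by positivity)).1 (by simpa using h1)
      intro t ht
      have h3 := congrFun h2 t
      simp only [Pi.zero_apply, mul_eq_zero, Nat.cast_eq_zero, ht, false_or] at h3
      exact (ENNReal.toReal_eq_zero_iff _).1 h3 |>.resolve_right (μ.apply_ne_top t)
  refine PMF.ext fun t => ?_
  have hk : μ k = 1 := by rw [← μ.tsum_coe, tsum_eq_single k key]
  by_cases h : t = k
  · subst h; simp [hk]
  · simp [key t h, h]

theorem IsTruncatedGeometric.le_of_ne_zero {κ : ℕ∞} {μ : PMF ℕ} (h : IsTruncatedGeometric κ μ)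
    (t : ℕ) (ht : μ t ≠ 0) : (t : ℕ∞) ≤ κ := by
  rcases h with ⟨p, q, -, -, -, -, h⟩ | ⟨k, rfl, rfl⟩
  · by_contra hc
    exact ht (h t (not_le.1 hc))
  · simp at ht
    simp [ht]

/-- Uniqueness of the truncated geometric distribution with given support and mean. -/
theorem IsTruncatedGeometric.unique {κ : ℕ∞} {μ ν : PMF ℕ} {x : ℝ}
    (hμ : IsTruncatedGeometric κ μ) (hν : IsTruncatedGeometric κ ν)
    (mμ : HasMean μ x) (mν : HasMean ν x) : μ = ν := by
  -- the point mass at `κ`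
  have top : ∀ {μ ν : PMF ℕ}, IsTruncatedGeometric κ ν → HasMean μ x → HasMean ν x →
      (∃ k : ℕ, κ = k ∧ μ = PMF.pure k) → μ = ν := by
    rintro μ ν hν mμ mν ⟨k, rfl, rfl⟩
    have hx : x = k := by
      refine mμ.unique ?_
      convert hasSum_single (f := fun t : ℕ => (t : ℝ) * ((PMF.pure k : PMF ℕ) t).toReal) k ?_
        using 1
      · simp
      · intro t ht; simp [ht]
    subst hx
    exact (eq_pure_of_mean mν (Or.inl fun t ht => by exact_mod_cast hν.le_of_ne_zero t ht)).symm
  -- the point mass at `0`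
  have zero : ∀ {μ ν : PMF ℕ} {p : ℝ}, HasMean μ x → HasMean ν x →
      (∀ t : ℕ, (t : ℕ∞) ≤ κ → (μ t).toReal = p * 0 ^ t) →
      (∀ t : ℕ, κ < (t : ℕ∞) → μ t = 0) → μ = ν := by
    intro μ ν p mμ mν h1 h2
    have h3 : ∀ t : ℕ, (t : ℝ) * (μ t).toReal = 0 := by
      intro t
      rcases le_or_gt (t : ℕ∞) κ with h | h
      · rw [h1 t h]; cases t <;> simp
      · simp [h2 t h]
    have hx : x = ((0 : ℕ) : ℝ) := by
      refine mμ.unique ?_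
      simp only [h3]
      simp
    subst hx
    rw [eq_pure_of_mean mμ (Or.inr rfl), eq_pure_of_mean mν (Or.inr rfl)]
  rcases hμ with ⟨p, q, hp, hp1, hq, h1, h2⟩ | hμ
  swap
  · exact top hν mμ mν hμ
  rcases hν with ⟨p', q', hp', hp1', hq', h1', h2'⟩ | hν
  swap
  · exact (top (Or.inl ⟨p, q, hp, hp1, hq, h1, h2⟩) mν mμ hν).symm
  rcases hq.eq_or_lt with rfl | hq
  · exact zero mμ mν h1 h2
  rcases hq'.eq_or_lt with rfl | hq'
  · exact (zero mν mμ h1' h2').symm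
  -- both have full support: `∑ (μ t - ν t) (ln μ t - ln ν t) = 0` has nonnegative terms
  have hs := (((hasSum_toReal μ).sub (hasSum_toReal ν)).mul_left (Real.log p - Real.log p')).add
    ((mμ.sub mν).mul_left (Real.log q - Real.log q'))
  simp only [sub_self, mul_zero, add_zero] at hs
  have ht : ∀ t : ℕ, (t : ℕ∞) ≤ κ →
      (Real.log p - Real.log p') * ((μ t).toReal - (ν t).toReal) +
        (Real.log q - Real.log q') * (t * (μ t).toReal - t * (ν t).toReal) =
      (Real.log (μ t).toReal - Real.log (ν t).toReal) * ((μ t).toReal - (ν t).toReal) := by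
    intro t h
    have e1 : Real.log (μ t).toReal = Real.log p + t * Real.log q := by
      rw [h1 t h, Real.log_mul hp.ne' (pow_pos hq t).ne', Real.log_pow]
    have e2 : Real.log (ν t).toReal = Real.log p' + t * Real.log q' := by
      rw [h1' t h, Real.log_mul hp'.ne' (pow_pos hq' t).ne', Real.log_pow]
    rw [e1, e2]; ring
  have hz := (hasSum_zero_iff_of_nonneg (fun t => by
    change (0 : ℝ) ≤ _
    rcases le_or_gt (t : ℕ∞) κ with h | h
    · rw [ht t h]
      have a1 : 0 < (μ t).toReal := by rw [h1 t h]; positivity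
      have a2 : 0 < (ν t).toReal := by rw [h1' t h]; positivity
      rcases le_total (μ t).toReal (ν t).toReal with hle | hle
      · exact mul_nonneg_of_nonpos_of_nonpos (sub_nonpos.2 (Real.log_le_log a1 hle))
          (sub_nonpos.2 hle)
      · exact mul_nonneg (sub_nonneg.2 (Real.log_le_log a2 hle)) (sub_nonneg.2 hle)
    · simp [h2 t h, h2' t h])).1 hs
  refine pmf_ext_toReal fun t => ?_
  rcases le_or_gt (t : ℕ∞) κ with h | h
  · have h3 := congrFun hz t
    simp only [Pi.zero_apply] at h3
    rw [ht t h] at h3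
    have a1 : 0 < (μ t).toReal := by rw [h1 t h]; positivity
    have a2 : 0 < (ν t).toReal := by rw [h1' t h]; positivity
    rcases mul_eq_zero.1 h3 with h4 | h4
    · exact Real.log_injOn_pos a1 a2 (by linarith)
    · linarith
  · simp [h2 t h, h2' t h]

/-- Existence of the truncated geometric distribution with given support and mean. -/
theorem exists_isTruncatedGeometric (κ : ℕ∞) {x : ℝ} (hx0 : 0 ≤ x)
    (hx : ∀ k : ℕ, κ = k → x ≤ k) : ∃ μ, IsTruncatedGeometric κ μ ∧ HasMean μ x := by
  induction κ using ENat.recTopCoe with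
  | top =>
    have hq0 : 0 ≤ x / (1 + x) := by positivity
    have hq1 : x / (1 + x) < 1 := by rw [div_lt_one (by positivity)]; linarith
    have h1x : (1 + x) ≠ 0 := by positivity
    have he : 1 - x / (1 + x) = 1 / (1 + x) := by field_simp; ring
    have hs : HasSum (fun t : ℕ => 1 / (1 + x) * (x / (1 + x)) ^ t) 1 := by
      have h := (hasSum_geometric_of_lt_one hq0 hq1).mul_left (1 / (1 + x))
      have e : 1 / (1 + x) * (1 - x / (1 + x))⁻¹ = 1 := by
        rw [he]; field_simp
      rwa [e] at h
    have hs' : HasSum (fun t : ℕ => ENNReal.ofReal (1 / (1 + x) * (x / (1 + x)) ^ t)) 1 := by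
      rw [ENNReal.summable.hasSum_iff, ← ENNReal.ofReal_tsum_of_nonneg
        (fun t => by positivity) hs.summable, hs.tsum_eq, ENNReal.ofReal_one]
    have hv : ∀ t : ℕ, (ENNReal.ofReal (1 / (1 + x) * (x / (1 + x)) ^ t)).toReal =
        1 / (1 + x) * (x / (1 + x)) ^ t := fun t => ENNReal.toReal_ofReal (by positivity)
    refine ⟨⟨_, hs'⟩, Or.inl ⟨1 / (1 + x), x / (1 + x), by positivity, ?_, hq0,
      fun t _ => hv t, by simp⟩, ?_⟩
    · rw [div_le_one (by positivity)]; linarith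
    · change HasSum (fun t : ℕ => (t : ℝ) *
        (ENNReal.ofReal (1 / (1 + x) * (x / (1 + x)) ^ t)).toReal) x
      simp only [hv]
      have h := (hasSum_coe_mul_geometric_of_norm_lt_one (r := x / (1 + x))
        (by rwa [Real.norm_of_nonneg hq0])).mul_left (1 / (1 + x))
      have e : 1 / (1 + x) * (x / (1 + x) / (1 - x / (1 + x)) ^ 2) = x := by
        rw [he]; field_simp
      rw [e] at h
      exact h.congr_fun fun t => by ring
  | coe k =>
    have hxk := hx k rfl
    rcases hxk.eq_or_lt with rfl | hxk
    · refine ⟨PMF.pure k, Or.inr ⟨k, rfl, rfl⟩, ?_⟩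
      unfold HasMean
      convert hasSum_single (f := fun t : ℕ => (t : ℝ) * ((PMF.pure k : PMF ℕ) t).toReal) k ?_
        using 1
      · simp
      · intro t ht; simp [ht]
    -- a root of `∑ (t - x) q ^ t`
    obtain ⟨q, hq, hroot⟩ : ∃ q : ℝ, 0 ≤ q ∧
        ∑ t ∈ Finset.range (k + 1), ((t : ℝ) - x) * q ^ t = 0 := by
      have hc : Continuous fun q : ℝ => ∑ t ∈ Finset.range (k + 1), ((t : ℝ) - x) * q ^ t := by
        fun_prop
      obtain ⟨Q, hQ1, hQ⟩ : ∃ Q : ℝ, 1 ≤ Q ∧ x * k ≤ (k - x) * Q := by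
        refine ⟨max 1 (x * k / (k - x)), le_max_left _ _, ?_⟩
        have h := sub_pos.2 hxk
        calc x * k = (k - x) * (x * k / (k - x)) := by field_simp
          _ ≤ _ := mul_le_mul_of_nonneg_left (le_max_right _ _) h.le
      have hQ0 : (0 : ℝ) ≤ Q := by linarith
      have h0 : ∑ t ∈ Finset.range (k + 1), ((t : ℝ) - x) * (0 : ℝ) ^ t ≤ 0 := by
        rw [Finset.sum_range_succ']
        simp [hx0]
      have hpos : 0 ≤ ∑ t ∈ Finset.range (k + 1), ((t : ℝ) - x) * Q ^ t := by
        rw [Finset.sum_range_succ]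
        cases k with
        | zero => simp at hxk; linarith
        | succ k =>
          have : ∑ t ∈ Finset.range (k + 1), (-x) * Q ^ k ≤
              ∑ t ∈ Finset.range (k + 1), ((t : ℝ) - x) * Q ^ t := by
            refine Finset.sum_le_sum fun t ht => ?_
            have h1 : Q ^ t ≤ Q ^ k :=
              pow_le_pow_right₀ hQ1 (Nat.lt_succ_iff.1 (Finset.mem_range.1 ht))
            have h2 : (0 : ℝ) ≤ t * Q ^ t := by positivity
            nlinarith [mul_le_mul_of_nonneg_left h1 hx0]
          rw [Finset.sum_const, Finset.card_range, nsmul_eq_mul] at this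
          have h3 := mul_le_mul_of_nonneg_right hQ (pow_nonneg hQ0 k)
          rw [pow_succ Q k]
          nlinarith
      obtain ⟨q, hq, h⟩ := intermediate_value_Icc hQ0 hc.continuousOn ⟨h0, hpos⟩
      exact ⟨q, hq.1, h⟩
    set S : ℝ := ∑ t ∈ Finset.range (k + 1), q ^ t with hS
    have hS1 : 1 ≤ S := by
      rw [hS, Finset.sum_range_succ']
      have : 0 ≤ ∑ t ∈ Finset.range k, q ^ (t + 1) := Finset.sum_nonneg fun t _ => by positivity
      simpa using this
    have hS0 : 0 < S := by linarith
    let f : ℕ → ℝ := fun t => if t ∈ Finset.range (k + 1) then S⁻¹ * q ^ t else 0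
    have hf0 : ∀ t, 0 ≤ f t := fun t => by
      simp only [f]; split_ifs <;> positivity
    have hf : HasSum f 1 := by
      have h : HasSum f (∑ t ∈ Finset.range (k + 1), f t) :=
        hasSum_sum_of_ne_finset_zero (fun t ht => by simp only [f, if_neg ht])
      have e : ∑ t ∈ Finset.range (k + 1), f t = 1 := by
        rw [Finset.sum_congr rfl (fun t ht => by simp only [f, if_pos ht] :
          ∀ t ∈ Finset.range (k + 1), f t = S⁻¹ * q ^ t), ← Finset.mul_sum, ← hS]
        exact inv_mul_cancel₀ hS0.ne'
      rwa [e] at h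
    have hs' : HasSum (fun t : ℕ => ENNReal.ofReal (f t)) 1 := by
      rw [ENNReal.summable.hasSum_iff, ← ENNReal.ofReal_tsum_of_nonneg hf0 hf.summable,
        hf.tsum_eq, ENNReal.ofReal_one]
    have hv : ∀ t : ℕ, (ENNReal.ofReal (f t)).toReal = f t :=
      fun t => ENNReal.toReal_ofReal (hf0 t)
    refine ⟨⟨_, hs'⟩, Or.inl ⟨S⁻¹, q, by positivity, inv_le_one_of_one_le₀ hS1, hq, ?_, ?_⟩, ?_⟩
    · intro t ht
      have ht' : t ∈ Finset.range (k + 1) :=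
        Finset.mem_range.2 (Nat.lt_succ_iff.2 (by exact_mod_cast ht))
      refine (hv t).trans ?_
      simp only [f, if_pos ht']
    · intro t ht
      have ht' : t ∉ Finset.range (k + 1) := by
        have : k < t := by exact_mod_cast ht
        simp; omega
      change ENNReal.ofReal (f t) = 0
      simp only [f, if_neg ht', ENNReal.ofReal_zero]
    · change HasSum (fun t : ℕ => (t : ℝ) * (ENNReal.ofReal (f t)).toReal) x
      simp only [hv]
      have h : HasSum (fun t : ℕ => (t : ℝ) * f t) (∑ t ∈ Finset.range (k + 1), (t : ℝ) * f t) :=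
        hasSum_sum_of_ne_finset_zero (fun t ht => by simp only [f, if_neg ht, mul_zero])
      have e : ∑ t ∈ Finset.range (k + 1), (t : ℝ) * f t = x := by
        have e1 : ∀ t ∈ Finset.range (k + 1),
            (t : ℝ) * f t = S⁻¹ * (((t : ℝ) - x) * q ^ t) + S⁻¹ * x * q ^ t := by
          intro t ht; simp only [f, if_pos ht]; ring
        rw [Finset.sum_congr rfl e1, Finset.sum_add_distrib, ← Finset.mul_sum, hroot,
          ← Finset.mul_sum, ← hS]
        field_simp; ring
      rwa [e] at h

/-- `TG(x;κ)` is the truncated geometric distribution with support `{0, 1, …, κ}` and mean `x`. -/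
theorem eq_TG_iff (κ : ℕ∞) {x : ℝ} (hx0 : 0 ≤ x) (hx : ∀ k : ℕ, κ = k → x ≤ k) (μ : PMF ℕ) :
    μ = TG κ x ↔ IsTruncatedGeometric κ μ ∧ HasMean μ x := by
  have h := exists_isTruncatedGeometric κ hx0 hx
  have hTG : TG κ x = h.choose := by rw [TG, dif_pos h]
  rw [hTG]
  refine ⟨?_, fun hμ => hμ.1.unique h.choose_spec.1 hμ.2 h.choose_spec.2⟩
  rintro rfl
  exact h.choose_spec

/-- `H^max_κ(x)`, the entropy of `TG(x;κ)`. -/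
def Hmax (κ : ℕ∞) (x : ℝ) : ℝ := entropy (TG κ x)

/-! ### The independence heuristic -/

open Classical in
/-- The `(κ+1)`-nomial coefficient: the coefficient of `x ^ r` in `(1 + x + ⋯ + x ^ κ) ^ n`. -/
def nomial (κ : ℕ∞) (n r : ℕ) : ℕ :=
  PowerSeries.coeff r ((PowerSeries.mk fun t : ℕ => if (t : ℕ∞) ≤ κ then (1 : ℕ) else 0) ^ n)

/-- The independence heuristic `I_κ(R,C)`, where `N` is the sum of the entries of `R`. -/
def indepHeuristic {m n : ℕ} (κ : ℕ∞) (R : Fin m → ℕ) (C : Fin n → ℕ) : ℝ :=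
  ((nomial κ (m * n) (∑ i, R i) : ℝ))⁻¹ *
    (∏ i, (nomial κ n (R i) : ℝ)) * ∏ j, (nomial κ m (C j) : ℝ)

end CTable

end

/-!
The maximum entropy `H^max_κ(x)` is the infimum over `q` of the functions
`ln (1 + q + ⋯ + q ^ κ) - x ln q`, which are affine in `x`; hence it is concave, continuous, and
bounds the logarithm of a `(κ+1)`-nomial coefficient. Conversely the coefficients of
`(1 + x + ⋯ + x ^ κ) ^ n` form a Pólya frequency sequence of order two, so for a suitable `q` the
term at `q ^ r` is a maximal one and carries the partition function up to a polynomial factor.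
Thus `ln (nomial κ n r) ≈ n H^max_κ(r / n)`, which gives the limit of the independence heuristic.

For the tables, subadditivity of entropy applied to a uniformly random table, followed by averaging
over the clones, bounds the logarithm of their number by the maximum over the polytope. For the
lower bound take a rational point near the maximizer, so that every entry times the size `h` of a
block is an integer, and fill each block row with arbitrary words of the prescribed sum. The nomial
asymptotics count the fillings. By pigeonhole many of them share their column sums, and shifting
the blocks cyclically corrects the column sums. Finally a table of `k s` clones can be
assembled from `k ^ 2` independent tables of `s` clones, so a lower bound at one size propagates to
all large sizes.
-/

noncomputable section

namespace CTable

/-! ### Maximum entropy and its dual -/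

/-- The possible means of a distribution on `{0, 1, …, κ}`. -/
def meanRange (κ : ℕ∞) : Set ℝ := {x | 0 ≤ x ∧ ∀ k : ℕ, κ = k → x ≤ k}

theorem convex_meanRange (κ : ℕ∞) : Convex ℝ (meanRange κ) := by
  rintro x ⟨hx, hxκ⟩ y ⟨hy, hyκ⟩ a b ha hb hab
  exact ⟨convex_Ici (0 : ℝ) hx hy ha hb hab,
    fun k hk => convex_Iic (k : ℝ) (hxκ k hk) (hyκ k hk) ha hb hab⟩

theorem natCast_mem_meanRange {κ : ℕ∞} {k : ℕ} : (k : ℝ) ∈ meanRange κ ↔ (k : ℕ∞) ≤ κ := by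
  induction κ using ENat.recTopCoe with
  | top => simp [meanRange]
  | coe K => simp [meanRange]

theorem TG_spec {κ : ℕ∞} {x : ℝ} (hx : x ∈ meanRange κ) :
    IsTruncatedGeometric κ (TG κ x) ∧ HasMean (TG κ x) x :=
  (eq_TG_iff κ hx.1 hx.2 _).1 rfl

theorem neg_mul_log_nonneg (μ : PMF ℕ) (t : ℕ) :
    0 ≤ -((μ t).toReal * Real.log (μ t).toReal) :=
  neg_nonneg.2 (Real.mul_log_nonpos ENNReal.toReal_nonneg
    (ENNReal.toReal_mono ENNReal.one_ne_top (μ.coe_le_one t)))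

theorem Hmax_nonneg (κ : ℕ∞) (x : ℝ) : 0 ≤ Hmax κ x :=
  tsum_nonneg (neg_mul_log_nonneg _)

/-- The unnormalized truncated geometric weights `q ^ t` on `{0, 1, …, κ}`. -/
def geomWeight (κ : ℕ∞) (q : ℝ) : ℕ → ℝ := Set.indicator {t | (t : ℕ∞) ≤ κ} (q ^ ·)

/-- The partition function `1 + q + ⋯ + q ^ κ`. -/
def partitionFn (κ : ℕ∞) (q : ℝ) : ℝ := ∑' t, geomWeight κ q t

/-- The positive parameters `q` at which the partition function converges. -/
def fugacities (κ : ℕ∞) : Set ℝ := {q | 0 < q ∧ Summable (geomWeight κ q)}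

/-- The Lagrangian dual function of entropy maximization under the mean constraint `x`: its
minimum over `q` is the maximum entropy. -/
def potential (κ : ℕ∞) (x q : ℝ) : ℝ := Real.log (partitionFn κ q) - x * Real.log q

theorem geomWeight_of_le {κ : ℕ∞} {t : ℕ} (q : ℝ) (ht : (t : ℕ∞) ≤ κ) :
    geomWeight κ q t = q ^ t :=
  Set.indicator_of_mem (s := {t : ℕ | (t : ℕ∞) ≤ κ}) ht _

theorem geomWeight_of_lt {κ : ℕ∞} {t : ℕ} (q : ℝ) (ht : κ < t) : geomWeight κ q t = 0 :=
  Set.indicator_of_notMem (s := {t : ℕ | (t : ℕ∞) ≤ κ}) (not_le.2 ht) _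

theorem geomWeight_nonneg (κ : ℕ∞) {q : ℝ} (hq : 0 ≤ q) (t : ℕ) : 0 ≤ geomWeight κ q t :=
  Set.indicator_nonneg (fun t _ => pow_nonneg hq t) t

theorem geomWeight_le_pow (κ : ℕ∞) {q : ℝ} (hq : 0 ≤ q) (t : ℕ) : geomWeight κ q t ≤ q ^ t :=
  Set.indicator_le_self' (fun t _ => pow_nonneg hq t) t

theorem hasSum_geomWeight_coe (k : ℕ) (q : ℝ) :
    HasSum (geomWeight k q) (∑ t ∈ Finset.range (k + 1), q ^ t) := by
  have h : ∑ t ∈ Finset.range (k + 1), geomWeight k q t = ∑ t ∈ Finset.range (k + 1), q ^ t :=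
    Finset.sum_congr rfl fun t ht =>
      geomWeight_of_le q (by exact_mod_cast Nat.lt_succ_iff.1 (Finset.mem_range.1 ht))
  rw [← h]
  refine hasSum_sum_of_ne_finset_zero fun t ht => geomWeight_of_lt q ?_
  exact_mod_cast (by simpa using ht : k + 1 ≤ t)

theorem partitionFn_coe (k : ℕ) (q : ℝ) :
    partitionFn k q = ∑ t ∈ Finset.range (k + 1), q ^ t :=
  (hasSum_geomWeight_coe k q).tsum_eq

theorem mem_fugacities_coe (k : ℕ) {q : ℝ} (hq : 0 < q) : q ∈ fugacities k :=
  ⟨hq, (hasSum_geomWeight_coe k q).summable⟩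

theorem mem_fugacities_of_lt_one (κ : ℕ∞) {q : ℝ} (hq : 0 < q) (hq1 : q < 1) :
    q ∈ fugacities κ :=
  ⟨hq, (summable_geometric_of_lt_one hq.le hq1).of_nonneg_of_le (geomWeight_nonneg κ hq.le)
    (geomWeight_le_pow κ hq.le)⟩

theorem partitionFn_le_inv_one_sub (κ : ℕ∞) {q : ℝ} (hq : 0 < q) (hq1 : q < 1) :
    partitionFn κ q ≤ (1 - q)⁻¹ := by
  rw [← tsum_geometric_of_lt_one hq.le hq1]
  exact (mem_fugacities_of_lt_one κ hq hq1).2.tsum_le_tsum (geomWeight_le_pow κ hq.le)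
    (summable_geometric_of_lt_one hq.le hq1)

theorem partitionFn_pos {κ : ℕ∞} {q : ℝ} (hq : q ∈ fugacities κ) : 0 < partitionFn κ q :=
  hq.2.tsum_pos (geomWeight_nonneg κ hq.1.le) 0 (by simp [geomWeight_of_le])

theorem entropy_le_potential {κ : ℕ∞} {μ : PMF ℕ} {x q : ℝ}
    (hμ : ∀ t, μ t ≠ 0 → (t : ℕ∞) ≤ κ) (hm : HasMean μ x) (hq : q ∈ fugacities κ) :
    entropy μ ≤ potential κ x q := by
  set Z := partitionFn κ q with hZ
  have hZ0 : 0 < Z := partitionFn_pos hq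
  have term_le : ∀ t : ℕ, -((μ t).toReal * Real.log (μ t).toReal) ≤
      Real.log Z * (μ t).toReal - Real.log q * (t * (μ t).toReal) +
        (Z⁻¹ * geomWeight κ q t - (μ t).toReal) := by
    intro t
    by_cases h0 : μ t = 0
    · simpa [h0] using mul_nonneg (inv_nonneg.2 hZ0.le) (geomWeight_nonneg κ hq.1.le t)
    have hpos : 0 < (μ t).toReal := ENNReal.toReal_pos h0 (μ.apply_ne_top t)
    have hqt : 0 < q ^ t := pow_pos hq.1 t
    have hlog := mul_le_mul_of_nonneg_left
      (Real.log_le_sub_one_of_pos (x := q ^ t / Z / (μ t).toReal) (by positivity)) hpos.le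
    rw [Real.log_div (by positivity) hpos.ne', Real.log_div hqt.ne' hZ0.ne', Real.log_pow,
      mul_sub_one, mul_div_cancel₀ _ hpos.ne'] at hlog
    rw [geomWeight_of_le q (hμ t h0), inv_mul_eq_div]
    linarith
  have hsum : HasSum (fun t : ℕ => Real.log Z * (μ t).toReal -
      Real.log q * (t * (μ t).toReal) + (Z⁻¹ * geomWeight κ q t - (μ t).toReal))
      (Real.log Z * 1 - Real.log q * x + (Z⁻¹ * Z - 1)) :=
    (((hasSum_toReal μ).mul_left _).sub (hm.mul_left _)).add
      ((hq.2.hasSum.mul_left _).sub (hasSum_toReal μ))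
  calc entropy μ ≤ Real.log Z * 1 - Real.log q * x + (Z⁻¹ * Z - 1) :=
        hasSum_le term_le
          (hsum.summable.of_nonneg_of_le (neg_mul_log_nonneg μ) term_le).hasSum hsum
    _ = potential κ x q := by rw [inv_mul_cancel₀ hZ0.ne', potential, ← hZ]; ring

theorem Hmax_le_potential {κ : ℕ∞} {x q : ℝ} (hx : x ∈ meanRange κ) (hq : q ∈ fugacities κ) :
    Hmax κ x ≤ potential κ x q :=
  entropy_le_potential (TG_spec hx).1.le_of_ne_zero (TG_spec hx).2 hq

theorem mem_fugacities_and_entropy_eq_potential {κ : ℕ∞} {μ : PMF ℕ} {x p q : ℝ}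
    (hp : 0 < p) (hq : 0 < q) (hμ : ∀ t, (μ t).toReal = p * geomWeight κ q t)
    (hm : HasMean μ x) : q ∈ fugacities κ ∧ entropy μ = potential κ x q := by
  have hw : HasSum (geomWeight κ q) p⁻¹ := by
    simpa [hμ, hp.ne'] using (hasSum_toReal μ).mul_left p⁻¹
  refine ⟨⟨hq, hw.summable⟩, ?_⟩
  have term_eq : ∀ t : ℕ, -((μ t).toReal * Real.log (μ t).toReal) =
      -Real.log p * (μ t).toReal - Real.log q * (t * (μ t).toReal) := by
    intro t
    rcases le_or_gt (t : ℕ∞) κ with ht | ht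
    · rw [hμ, geomWeight_of_le q ht, Real.log_mul hp.ne' (pow_pos hq t).ne', Real.log_pow]
      ring
    · simp [hμ, geomWeight_of_lt q ht]
  have hent : HasSum (fun t => -((μ t).toReal * Real.log (μ t).toReal))
      (-Real.log p * 1 - Real.log q * x) := by
    simp only [term_eq]
    exact ((hasSum_toReal μ).mul_left _).sub (hm.mul_left _)
  rw [entropy, hent.tsum_eq, potential, partitionFn, hw.tsum_eq, Real.log_inv]
  ring

theorem exists_log_partitionFn_lt (κ : ℕ∞) {ε : ℝ} (hε : 0 < ε) :
    ∃ q ∈ fugacities κ, Real.log (partitionFn κ q) < ε := by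
  have hexp : Real.exp (-(ε / 2)) < 1 := Real.exp_lt_one_iff.2 (by linarith)
  have hq : 0 < 1 - Real.exp (-(ε / 2)) := sub_pos.2 hexp
  have hq1 : 1 - Real.exp (-(ε / 2)) < 1 := sub_lt_self _ (Real.exp_pos _)
  have hmem := mem_fugacities_of_lt_one κ hq hq1
  refine ⟨_, hmem, ?_⟩
  calc Real.log (partitionFn κ _)
      ≤ Real.log (1 - (1 - Real.exp (-(ε / 2))))⁻¹ :=
        Real.log_le_log (partitionFn_pos hmem) (partitionFn_le_inv_one_sub κ hq hq1)
    _ = ε / 2 := by rw [sub_sub_cancel, Real.log_inv, Real.log_exp, neg_neg]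
    _ < ε := half_lt_self hε

theorem exists_potential_zero_lt (κ : ℕ∞) {ε : ℝ} (hε : 0 < ε) :
    ∃ q ∈ fugacities κ, potential κ 0 q < ε := by
  simpa [potential] using exists_log_partitionFn_lt κ hε

theorem potential_self_inv (k : ℕ) {q : ℝ} (hq : 0 < q) :
    potential k k q⁻¹ = Real.log (partitionFn k q) := by
  have hrev : partitionFn k q = q ^ k * partitionFn k q⁻¹ := by
    rw [partitionFn_coe, partitionFn_coe, Finset.mul_sum, ← Finset.sum_range_reflect]
    refine Finset.sum_congr rfl fun t ht => ?_
    rw [Nat.add_sub_cancel, pow_sub₀ q hq.ne' (Nat.lt_succ_iff.1 (Finset.mem_range.1 ht)), inv_pow]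
  rw [hrev, Real.log_mul (pow_pos hq k).ne'
    (partitionFn_pos (mem_fugacities_coe k (inv_pos.2 hq))).ne', potential, Real.log_pow,
    Real.log_inv]
  ring

theorem exists_potential_self_lt (k : ℕ) {ε : ℝ} (hε : 0 < ε) :
    ∃ q ∈ fugacities k, potential k k q < ε := by
  obtain ⟨q, hq, hlt⟩ := exists_log_partitionFn_lt k hε
  exact ⟨q⁻¹, mem_fugacities_coe k (inv_pos.2 hq.1), by rwa [potential_self_inv k hq.1]⟩

theorem Hmax_zero (κ : ℕ∞) : Hmax κ 0 = 0 := by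
  refine le_antisymm (le_of_forall_pos_le_add fun ε hε => ?_) (Hmax_nonneg κ 0)
  obtain ⟨q, hq, hlt⟩ := exists_potential_zero_lt κ hε
  have h0 : (0 : ℝ) ∈ meanRange κ := ⟨le_rfl, fun k _ => k.cast_nonneg⟩
  linarith [Hmax_le_potential h0 hq]

theorem Hmax_self (k : ℕ) : Hmax k k = 0 := by
  refine le_antisymm (le_of_forall_pos_le_add fun ε hε => ?_) (Hmax_nonneg k k)
  obtain ⟨q, hq, hlt⟩ := exists_potential_self_lt k hε
  linarith [Hmax_le_potential (natCast_mem_meanRange.2 le_rfl) hq]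

theorem hasMean_pure (k : ℕ) : HasMean (PMF.pure k) k := by
  unfold HasMean
  convert hasSum_single (f := fun t : ℕ => (t : ℝ) * ((PMF.pure k : PMF ℕ) t).toReal) k ?_ using 1
  · simp
  · intro t ht
    simp [ht]

theorem exists_potential_lt {κ : ℕ∞} {x ε : ℝ} (hx : x ∈ meanRange κ) (hε : 0 < ε) :
    ∃ q ∈ fugacities κ, potential κ x q < Hmax κ x + ε := by
  have hlt : ε ≤ Hmax κ x + ε := le_add_of_nonneg_left (Hmax_nonneg κ x)
  obtain ⟨⟨p, q, hp, -, hq, hle, hgt⟩ | ⟨k, rfl, hpure⟩, hm⟩ := TG_spec hx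
  · have hTG : ∀ t, (TG κ x t).toReal = p * geomWeight κ q t := fun t => by
      rcases le_or_gt (t : ℕ∞) κ with ht | ht
      · rw [hle t ht, geomWeight_of_le q ht]
      · simp [hgt t ht, geomWeight_of_lt q ht]
    obtain rfl | hq := hq.eq_or_lt
    · have hx0 : x = 0 := hm.unique (by
        convert hasSum_zero with t
        obtain rfl | ht := eq_or_ne t 0
        · simp
        · simpa [hTG, ht] using
            Or.inr (le_antisymm (by simpa [ht] using geomWeight_le_pow κ le_rfl t)
              (geomWeight_nonneg κ le_rfl t)))
      subst hx0
      obtain ⟨q, hq, h⟩ := exists_potential_zero_lt κ hε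
      exact ⟨q, hq, h.trans_le hlt⟩
    · obtain ⟨hmem, heq⟩ :=
        mem_fugacities_and_entropy_eq_potential hp hq hTG hm
      exact ⟨q, hmem, by rw [Hmax, heq]; exact lt_add_of_pos_right _ hε⟩
  · obtain rfl : x = k := hm.unique (hpure ▸ hasMean_pure k)
    obtain ⟨q, hq, h⟩ := exists_potential_self_lt k hε
    exact ⟨q, hq, h.trans_le hlt⟩

/-- `H^max_κ` is an infimum of affine functions. -/
theorem concaveOn_Hmax (κ : ℕ∞) : ConcaveOn ℝ (meanRange κ) (Hmax κ) := by
  refine ⟨convex_meanRange κ, fun x hx y hy a b ha hb hab => le_of_forall_pos_le_add fun ε hε => ?_⟩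
  obtain ⟨q, hq, hlt⟩ := exists_potential_lt (convex_meanRange κ hx hy ha hb hab) hε
  calc a • Hmax κ x + b • Hmax κ y ≤ a • potential κ x q + b • potential κ y q := by
        simp only [smul_eq_mul]
        gcongr
        exacts [Hmax_le_potential hx hq, Hmax_le_potential hy hq]
    _ = potential κ (a • x + b • y) q := by
        simp only [potential, smul_eq_mul]
        linear_combination Real.log (partitionFn κ q) * hab
    _ ≤ Hmax κ (a • x + b • y) + ε := hlt.le

theorem Hmax_eq_zero_or_mem_interior {κ : ℕ∞} {x : ℝ} (hx : x ∈ meanRange κ) :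
    Hmax κ x = 0 ∨ x ∈ interior (meanRange κ) := by
  obtain rfl | h0 := hx.1.eq_or_lt
  · exact Or.inl (Hmax_zero κ)
  induction κ using ENat.recTopCoe with
  | top =>
    exact Or.inr (mem_interior_iff_mem_nhds.2 (mem_of_superset (Ioi_mem_nhds h0)
      fun y hy => ⟨le_of_lt hy, fun k hk => absurd hk (ENat.top_ne_natCast k)⟩))
  | coe k =>
    obtain rfl | hk := (hx.2 k rfl).eq_or_lt
    · exact Or.inl (Hmax_self k)
    · exact Or.inr (mem_interior_iff_mem_nhds.2 (mem_of_superset (Ioo_mem_nhds h0 hk)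
        fun y hy => ⟨hy.1.le, fun j hj => ENat.natCast_inj.1 hj ▸ hy.2.le⟩))

theorem continuousOn_Hmax (κ : ℕ∞) : ContinuousOn (Hmax κ) (meanRange κ) := by
  refine fun x hx => tendsto_order.2 ⟨fun a ha => ?_, fun a ha => ?_⟩
  · obtain h0 | hint := Hmax_eq_zero_or_mem_interior hx
    · exact Eventually.of_forall fun y => (h0 ▸ ha).trans_le (Hmax_nonneg κ y)
    · exact nhdsWithin_le_nhds (((concaveOn_Hmax κ).continuousOn_interior.continuousAt
        (isOpen_interior.mem_nhds hint)).eventually_const_lt ha)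
  · obtain ⟨q, hq, hlt⟩ := exists_potential_lt hx (sub_pos.2 ha)
    have hcont : Continuous fun y => potential κ y q := by unfold potential; fun_prop
    filter_upwards [self_mem_nhdsWithin, nhdsWithin_le_nhds
      (hcont.continuousAt.eventually_lt_const (by linarith : potential κ x q < a))] with y hy hya
    exact (Hmax_le_potential hy hq).trans_lt hya

theorem sum_Hmax_le {ι : Type*} [Fintype ι] {κ : ℕ∞} {x : ι → ℝ} (hx : ∀ i, x i ∈ meanRange κ) :
    ∑ i, Hmax κ (x i) ≤ Fintype.card ι * Hmax κ ((∑ i, x i) / Fintype.card ι) := by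
  cases isEmpty_or_nonempty ι
  · simp
  have hpos : (0 : ℝ) < Fintype.card ι := by exact_mod_cast Fintype.card_pos
  have h := (concaveOn_Hmax κ).le_map_sum (t := Finset.univ) (p := x)
    (w := fun _ => (Fintype.card ι : ℝ)⁻¹) (fun _ _ => by positivity) (by simp [hpos.ne'])
    fun i _ => hx i
  simp only [smul_eq_mul, ← Finset.mul_sum] at h
  rw [div_eq_inv_mul]
  exact (inv_mul_le_iff₀ hpos).1 h

/-! ### Lower bound for the nomial coefficients -/

open Classical in
/-- The vectors indexed by `ι` with entries in `{0, …, κ}` and sum `k`. -/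
def boundedVectors (κ : ℕ∞) (ι : Type*) [Fintype ι] (k : ℕ) : Finset (ι → ℕ) :=
  (Finset.piAntidiag Finset.univ k).filter fun u => ∀ i, (u i : ℕ∞) ≤ κ

theorem mem_boundedVectors {κ : ℕ∞} {ι : Type*} [Fintype ι] {k : ℕ} {u : ι → ℕ} :
    u ∈ boundedVectors κ ι k ↔ (∀ i, (u i : ℕ∞) ≤ κ) ∧ ∑ i, u i = k := by
  simp [boundedVectors, and_comm]

theorem card_boundedVectors (κ : ℕ∞) (ι : Type*) [Fintype ι] (k : ℕ) :
    (boundedVectors κ ι k).card = nomial κ (Fintype.card ι) k := by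
  classical
  rw [nomial, ← Finset.card_univ, ← Finset.prod_const, PowerSeries.coeff_prod, boundedVectors,
    Finset.card_filter]
  refine Finset.sum_nbij' Finsupp.equivFunOnFinite.symm (fun l => ⇑l) ?_ ?_ ?_ ?_ ?_
  · exact fun u hu => by simpa using hu
  · exact fun l hl => by simpa using hl
  · exact fun u _ => by simp
  · exact fun l _ => by simp
  · intro u _
    simp only [PowerSeries.coeff_mk, Finsupp.equivFunOnFinite_symm_apply_apply]
    rw [Fintype.prod_ite_zero]
    simp

theorem card_boundedVectors_fin (κ : ℕ∞) (n k : ℕ) :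
    (boundedVectors κ (Fin n) k).card = nomial κ n k := by
  rw [card_boundedVectors, Fintype.card_fin]

theorem nomial_pos_iff {κ : ℕ∞} {ι : Type*} [Fintype ι] {k : ℕ} :
    0 < nomial κ (Fintype.card ι) k ↔ ∃ u : ι → ℕ, (∀ i, (u i : ℕ∞) ≤ κ) ∧ ∑ i, u i = k := by
  rw [← card_boundedVectors, Finset.card_pos]
  exact exists_congr fun u => mem_boundedVectors

theorem nomial_mul_pos {κ : ℕ∞} {n k : ℕ} (h : 0 < nomial κ n k) (t : ℕ) :
    0 < nomial κ (t * n) (t * k) := by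
  obtain ⟨u, hu, hk⟩ := nomial_pos_iff (ι := Fin n).1 (by simpa using h)
  simpa using nomial_pos_iff (ι := Fin t × Fin n) (k := t * k).2
    ⟨fun x => u x.2, fun x => hu x.2, by simp [Fintype.sum_prod_type, hk]⟩

theorem nomial_zero_right (κ : ℕ∞) (n : ℕ) : nomial κ n 0 = 1 := by
  rw [← card_boundedVectors_fin, Finset.card_eq_one]
  refine ⟨0, Finset.ext fun u => ?_⟩
  simp only [mem_boundedVectors, Finset.sum_eq_zero_iff, Finset.mem_univ, true_imp_iff,
    Finset.mem_singleton]
  exact ⟨fun h => funext h.2, by rintro rfl; simp⟩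

theorem nomial_le_pow (κ : ℕ∞) (n k : ℕ) : nomial κ n k ≤ (k + 1) ^ n := by
  calc nomial κ n k = (boundedVectors κ (Fin n) k).card := (card_boundedVectors_fin κ n k).symm
    _ ≤ (Fintype.piFinset fun _ : Fin n => Finset.range (k + 1)).card := by
        refine Finset.card_le_card fun u hu => Fintype.mem_piFinset.2 fun j => ?_
        rw [Finset.mem_range_succ_iff, ← (mem_boundedVectors.1 hu).2]
        exact Finset.single_le_sum (fun _ _ => Nat.zero_le _) (Finset.mem_univ j)
    _ = (k + 1) ^ n := by simp

theorem nomial_one (n k : ℕ) : nomial (1 : ℕ) n k = n.choose k := by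
  classical
  have hX : (PowerSeries.mk fun t : ℕ => if (t : ℕ∞) ≤ (1 : ℕ) then (1 : ℕ) else 0) =
      ((1 + Polynomial.X : Polynomial ℕ) : PowerSeries ℕ) := by
    ext t
    rw [PowerSeries.coeff_mk, Polynomial.coeff_coe, Polynomial.coeff_add, Polynomial.coeff_one,
      Polynomial.coeff_X]
    simp only [Nat.cast_le]
    grind
  rw [nomial, hX, ← Polynomial.coe_pow, Polynomial.coeff_coe, Polynomial.coeff_one_add_X_pow,
    Nat.cast_id]

theorem nomial_top (d k : ℕ) : nomial ⊤ (d + 1) k = (d + k).choose d := by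
  have hmap : (PowerSeries.mk fun t : ℕ => if (t : ℕ∞) ≤ ⊤ then (1 : ℕ) else 0).map
      (Nat.castRingHom ℤ) = PowerSeries.mk 1 := by
    ext t
    simp
  have h := congrArg (PowerSeries.coeff k) (PowerSeries.mk_one_pow_eq_mk_choose_add ℤ d)
  rw [← hmap, ← map_pow, PowerSeries.coeff_map, PowerSeries.coeff_mk, eq_natCast] at h
  rw [nomial]
  exact_mod_cast h

theorem choose_le_mul_nomial_top {n : ℕ} (hn : 0 < n) (k : ℕ) :
    (n + k).choose k ≤ (n + k) * nomial ⊤ n k := by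
  obtain ⟨d, rfl⟩ := Nat.exists_eq_add_one.2 hn
  rw [nomial_top, ← Nat.choose_symm_add, Nat.add_right_comm, Nat.add_one_mul_choose_eq]
  exact Nat.le_mul_of_pos_right _ d.succ_pos

theorem sum_nomial_mul_pow (K n : ℕ) (y : ℝ) :
    ∑ j ∈ Finset.range (n * K + 1), (nomial K n j : ℝ) * y ^ j = partitionFn K y ^ n := by
  classical
  rw [partitionFn_coe, ← Fin.prod_const, Finset.prod_univ_sum,
    ← Finset.sum_fiberwise_of_maps_to (t := Finset.range (n * K + 1))
      (g := fun u : Fin n → ℕ => ∑ i, u i)]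
  · refine Finset.sum_congr rfl fun j _ => ?_
    have hfiber : boundedVectors K (Fin n) j =
        {u ∈ Fintype.piFinset fun _ : Fin n => Finset.range (K + 1) | ∑ i, u i = j} := by
      ext u
      simp [mem_boundedVectors]
    rw [← hfiber, Finset.sum_congr rfl fun u hu => by
      rw [Finset.prod_pow_eq_pow_sum, (mem_boundedVectors.1 hu).2],
      Finset.sum_const, nsmul_eq_mul, card_boundedVectors_fin]
  · intro u hu
    simp only [Fintype.mem_piFinset, Finset.mem_range, Nat.lt_succ_iff] at hu ⊢
    exact (Finset.sum_le_sum fun i _ => hu i).trans_eq (by simp)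

/-- A Pólya frequency sequence of order two: a log-concave sequence without internal zeros. -/
def IsPF2 {R : Type*} [Mul R] [LE R] (a : ℤ → R) : Prop :=
  ∀ ⦃i j : ℤ⦄, i ≤ j → a i * a (j + 1) ≤ a (i + 1) * a j

theorem IsPF2.mul_add_le_mul {R : Type*} [CommMonoid R] [Preorder R] {a : ℤ → R} (ha : IsPF2 a)
    (d : ℕ) : ∀ {i j : ℤ}, i ≤ j → a i * a (j + d) ≤ a (i + d) * a j := by
  induction d with
  | zero => simp
  | succ d ih =>
    intro i j hij
    obtain rfl | hlt := hij.eq_or_lt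
    · rw [mul_comm]
    calc a i * a (j + (d + 1 : ℕ)) = a i * a (j + d + 1) := by push_cast; rw [add_assoc]
      _ ≤ a (i + 1) * a (j + d) := ha (by lia)
      _ ≤ a (i + 1 + d) * a j := ih hlt
      _ = a (i + (d + 1 : ℕ)) * a j := by push_cast; rw [add_right_comm, add_assoc]

/-- The sums of `a` over windows of length `K + 1`, that is, the convolution of `a` with
`1 + x + ⋯ + x ^ K`. -/
def windowSum {R : Type*} [AddCommMonoid R] (K : ℕ) (a : ℤ → R) (j : ℤ) : R :=
  ∑ t ∈ Finset.range (K + 1), a (j - t)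

theorem windowSum_add_one {R : Type*} [AddCommGroup R] (K : ℕ) (a : ℤ → R) (j : ℤ) :
    windowSum K a (j + 1) = windowSum K a j + a (j + 1) - a (j - K) := by
  rw [windowSum, windowSum, Finset.sum_range_succ', Finset.sum_range_succ _ K]
  simp only [Nat.cast_add, Nat.cast_one, Nat.cast_zero, add_sub_add_right_eq_sub, sub_zero]
  abel

theorem IsPF2.map_windowSum {R : Type*} [CommRing R] [PartialOrder R] [IsOrderedRing R]
    {a : ℤ → R} (ha : IsPF2 a) (K : ℕ) : IsPF2 (windowSum K a) := by
  intro i j hij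
  have hnew : windowSum K a i * a (j + 1) ≤ windowSum K a j * a (i + 1) := by
    simp only [windowSum, Finset.sum_mul]
    refine Finset.sum_le_sum fun t _ => ?_
    convert ha.mul_add_le_mul (t + 1) (i := i - t) (j := j - t) (by lia) using 1
    · congr 2; push_cast; ring
    · rw [mul_comm]; congr 2; push_cast; ring
  have hold : windowSum K a j * a (i - K) ≤ windowSum K a i * a (j - K) := by
    simp only [windowSum, Finset.sum_mul]
    refine Finset.sum_le_sum fun t ht => ?_
    have htK := Finset.mem_range_succ_iff.1 ht
    convert ha.mul_add_le_mul (K - t) (i := i - K) (j := j - K) (by lia) using 1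
    · rw [mul_comm]; congr 2; push_cast [htK]; ring
    · congr 2; push_cast [htK]; ring
  rw [windowSum_add_one, windowSum_add_one, ← sub_nonneg]
  convert add_nonneg (sub_nonneg.2 hnew) (sub_nonneg.2 hold) using 1
  ring

theorem IsPF2.exists_max_term {a : ℤ → ℝ} (ha : IsPF2 a) {k : ℤ} (hk : 0 < a k)
    (hk' : 0 < a (k - 1)) : ∃ q : ℝ, 0 < q ∧ ∀ j, a j * q ^ j ≤ a k * q ^ k := by
  have hq : 0 < a (k - 1) / a k := div_pos hk' hk
  refine ⟨a (k - 1) / a k, hq, fun j => ?_⟩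
  obtain hjk | hkj := le_total j k
  · induction j, hjk using Int.leInductionDown with
    | base => exact le_rfl
    | pred j hj ih =>
      refine le_trans ?_ ih
      have h : a (j - 1) * a k ≤ a j * a (k - 1) := by
        simpa using ha (sub_le_sub_right hj 1)
      calc a (j - 1) * (a (k - 1) / a k) ^ (j - 1)
          ≤ a j * (a (k - 1) / a k) * (a (k - 1) / a k) ^ (j - 1) := by
            gcongr
            rwa [← mul_div_assoc, le_div_iff₀ hk]
        _ = a j * (a (k - 1) / a k) ^ j := by
            rw [mul_assoc, ← zpow_one_add₀ hq.ne', add_sub_cancel]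
  · induction j, hkj using Int.leInduction with
    | base => exact le_rfl
    | succ j hj ih =>
      refine le_trans ?_ ih
      have h : a (k - 1) * a (j + 1) ≤ a k * a j := by
        simpa using ha ((sub_one_lt k).le.trans hj)
      calc a (j + 1) * (a (k - 1) / a k) ^ (j + 1)
          = a (j + 1) * (a (k - 1) / a k) * (a (k - 1) / a k) ^ j := by
            rw [mul_assoc, ← zpow_one_add₀ hq.ne', add_comm]
        _ ≤ a j * (a (k - 1) / a k) ^ j := by
            gcongr
            rwa [← mul_div_assoc, div_le_iff₀ hk, mul_comm, mul_comm (a j)]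

/-- The sequence `j ↦ nomial K n j`, extended by zero to the integers. -/
def nomialSeq (K n : ℕ) : ℤ → ℝ
  | (j : ℕ) => nomial K n j
  | Int.negSucc _ => 0

theorem nomial_succ (K n j : ℕ) : nomial K (n + 1) j =
    ∑ t ∈ Finset.range (K + 1), if t ≤ j then nomial K n (j - t) else 0 := by
  classical
  rw [nomial, pow_succ', PowerSeries.coeff_mul,
    Finset.Nat.sum_antidiagonal_eq_sum_range_succ_mk]
  simp only [PowerSeries.coeff_mk, Nat.cast_le, ite_mul, one_mul, zero_mul, ← Finset.sum_filter]
  refine Finset.sum_congr (by ext t; simp; lia) fun t _ => by simp [nomial]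

theorem nomialSeq_succ (K n : ℕ) : nomialSeq K (n + 1) = windowSum K (nomialSeq K n) := by
  funext j
  cases j with
  | ofNat j =>
    change (nomial K (n + 1) j : ℝ) = _
    rw [nomial_succ, Nat.cast_sum]
    refine Finset.sum_congr rfl fun t _ => ?_
    split_ifs with htj
    · rw [Int.ofNat_eq_natCast, ← Nat.cast_sub htj]
      rfl
    · rw [Int.ofNat_eq_natCast, show (j : ℤ) - t = Int.negSucc (t - j - 1) by lia]
      exact Nat.cast_zero
  | negSucc j =>
    refine (Finset.sum_eq_zero fun t _ => ?_).symm
    rw [show Int.negSucc j - t = Int.negSucc (j + t) by lia]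
    rfl

theorem nomialSeq_zero (K : ℕ) : nomialSeq K 0 = Pi.single 0 1 := by
  funext j
  cases j with
  | ofNat j =>
    change (nomial K 0 j : ℝ) = _
    simp [nomial, PowerSeries.coeff_one, Pi.single_apply]
  | negSucc j => rfl

theorem isPF2_single : IsPF2 (Pi.single 0 1 : ℤ → ℝ) := by
  intro i j hij
  have hnonneg : (0 : ℤ → ℝ) ≤ Pi.single 0 1 := Pi.single_nonneg.2 zero_le_one
  obtain rfl | hi := eq_or_ne i 0
  · rw [Pi.single_eq_of_ne (i' := j + 1) (by lia), mul_zero]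
    exact mul_nonneg (hnonneg _) (hnonneg _)
  · rw [Pi.single_eq_of_ne hi, zero_mul]
    exact mul_nonneg (hnonneg _) (hnonneg _)

theorem isPF2_nomialSeq (K n : ℕ) : IsPF2 (nomialSeq K n) := by
  induction n with
  | zero => exact nomialSeq_zero K ▸ isPF2_single
  | succ n ih => exact nomialSeq_succ K n ▸ ih.map_windowSum K

theorem exists_nomial_max_term {K n k : ℕ} (hk : 0 < k) (h : 0 < nomial K n k) :
    ∃ q : ℝ, 0 < q ∧ ∀ j, nomial K n j * q ^ j ≤ nomial K n k * q ^ k := by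
  have hpos : (0 : ℝ) < nomial K n k := by exact_mod_cast h
  have hPF2 := isPF2_nomialSeq K n
  obtain ⟨k, rfl⟩ := Nat.exists_eq_add_one.2 hk
  have hprev : (0 : ℝ) < nomial K n k := by
    have h1 : (nomial K n 0 : ℝ) * nomial K n (k + 1) ≤ nomial K n 1 * nomial K n k :=
      hPF2 (Int.natCast_nonneg k)
    rw [nomial_zero_right, Nat.cast_one, one_mul] at h1
    exact pos_of_mul_pos_right (hpos.trans_le h1) (Nat.cast_nonneg _)
  obtain ⟨q, hq, hmax⟩ := hPF2.exists_max_term (k := (k + 1 : ℕ)) hpos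
    (by rwa [Nat.cast_add_one, add_sub_cancel_right])
  refine ⟨q, hq, fun j => ?_⟩
  have hj := hmax j
  rwa [zpow_natCast, zpow_natCast] at hj

theorem exists_partitionFn_pow_le {K n k : ℕ} (hk : 0 < k) (h : 0 < nomial K n k) :
    ∃ q : ℝ, 0 < q ∧ partitionFn K q ^ n ≤ (n * K + 1) * (nomial K n k * q ^ k) := by
  obtain ⟨q, hq, hmax⟩ := exists_nomial_max_term hk h
  refine ⟨q, hq, ?_⟩
  calc partitionFn K q ^ n = ∑ j ∈ Finset.range (n * K + 1), (nomial K n j : ℝ) * q ^ j :=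
        (sum_nomial_mul_pow K n q).symm
    _ ≤ ∑ _j ∈ Finset.range (n * K + 1), (nomial K n k * q ^ k : ℝ) :=
        Finset.sum_le_sum fun j _ => hmax j
    _ = (n * K + 1) * (nomial K n k * q ^ k) := by simp

/-- The substitution `q = y / (1 + y)` turns the binomial theorem, that is, the case `κ = 1` for
vectors of length `n + k`, into the case `κ = ∞` for vectors of length `n`. -/
theorem exists_partitionFn_top_pow_le {n k : ℕ} (hn : 0 < n) (hk : 0 < k) :
    ∃ q ∈ fugacities ⊤,
      partitionFn ⊤ q ^ n ≤ (n + k + 1) * (n + k) * (nomial ⊤ n k * q ^ k) := by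
  obtain ⟨y, hy, hle⟩ := exists_partitionFn_pow_le (K := 1) (n := n + k) hk
    (by rw [nomial_one]; exact Nat.choose_pos (Nat.le_add_left k n))
  have hchoose : ((n + k).choose k : ℝ) ≤ (n + k) * nomial ⊤ n k := by
    exact_mod_cast choose_le_mul_nomial_top hn k
  have hq : 0 < y / (1 + y) := by positivity
  have hq1 : y / (1 + y) < 1 := by rw [div_lt_one (by positivity)]; linarith
  have hmem := mem_fugacities_of_lt_one ⊤ hq hq1
  refine ⟨y / (1 + y), hmem, ?_⟩
  have hZ : partitionFn (1 : ℕ) y = 1 + y := by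
    rw [partitionFn_coe]
    simp [Finset.sum_range_succ]
  have hle' : (1 + y) ^ (n + k) ≤ (n + k + 1) * ((n + k) * nomial ⊤ n k * y ^ k) := by
    rw [hZ, nomial_one] at hle
    refine hle.trans ?_
    push_cast
    rw [mul_one]
    gcongr
  calc partitionFn ⊤ (y / (1 + y)) ^ n ≤ ((1 - y / (1 + y))⁻¹) ^ n :=
        pow_le_pow_left₀ (partitionFn_pos hmem).le (partitionFn_le_inv_one_sub ⊤ hq hq1) n
    _ = (1 + y) ^ n := by congr 1; field_simp; ring
    _ = (1 + y) ^ (n + k) / (1 + y) ^ k := by rw [pow_add]; field_simp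
    _ ≤ (n + k + 1) * ((n + k) * nomial ⊤ n k * y ^ k) / (1 + y) ^ k := by gcongr
    _ = (n + k + 1) * (n + k) * (nomial ⊤ n k * (y / (1 + y)) ^ k) := by rw [div_pow]; ring

theorem average_mem_meanRange {α : Type*} {κ : ℕ∞} {s : Finset α} {x : α → ℝ}
    (hx : ∀ a ∈ s, x a ∈ meanRange κ) : (∑ a ∈ s, x a) / s.card ∈ meanRange κ := by
  obtain rfl | hs := s.eq_empty_or_nonempty
  · simpa using natCast_mem_meanRange (κ := κ).2 bot_le
  rw [div_eq_inv_mul, Finset.mul_sum]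
  exact (convex_meanRange κ).sum_mem (fun _ _ => by positivity) (by simp [hs.card_ne_zero]) hx

theorem sum_average_eq {α ι : Type*} [Fintype ι] {s : Finset α} {x : α → ι → ℝ} {c : ℝ}
    (hs : s.Nonempty) (hx : ∀ a ∈ s, ∑ i, x a i = c) : ∑ i, (∑ a ∈ s, x a i) / s.card = c := by
  rw [← Finset.sum_div, Finset.sum_comm, Finset.sum_congr rfl hx, Finset.sum_const, nsmul_eq_mul,
    mul_div_cancel_left₀ _ (by exact_mod_cast hs.card_pos.ne')]

theorem div_mem_meanRange_of_nomial_pos {κ : ℕ∞} {n k : ℕ} (h : 0 < nomial κ n k) :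
    (k / n : ℝ) ∈ meanRange κ := by
  obtain ⟨u, hu, rfl⟩ := nomial_pos_iff (ι := Fin n).1 (by simpa using h)
  simpa using average_mem_meanRange fun i (_ : i ∈ Finset.univ) => natCast_mem_meanRange.2 (hu i)

theorem exists_partitionFn_pow_le_sq_mul {κ : ℕ∞} {n k : ℕ} (hn : 0 < n) (hk : 0 < k)
    (h : 0 < nomial κ n k) : ∃ q ∈ fugacities κ,
      partitionFn κ q ^ n ≤ ((κ.toNat + 1) * n + k + 1) ^ 2 * (nomial κ n k * q ^ k) := by
  induction κ using ENat.recTopCoe with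
  | top =>
    obtain ⟨q, hq, hle⟩ := exists_partitionFn_top_pow_le hn hk
    refine ⟨q, hq, hle.trans ?_⟩
    have := pow_pos hq.1 k
    gcongr
    rw [ENat.toNat_top, Nat.cast_zero, zero_add, one_mul, sq]
    exact mul_le_mul_of_nonneg_left (le_add_of_nonneg_right zero_le_one) (by positivity)
  | coe K =>
    obtain ⟨q, hq, hle⟩ := exists_partitionFn_pow_le hk h
    refine ⟨q, mem_fugacities_coe K hq, hle.trans ?_⟩
    gcongr
    rw [ENat.toNat_natCast]
    calc (n * K + 1 : ℝ) ≤ (K + 1) * n + k + 1 := by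
          linarith [n.cast_nonneg (α := ℝ), k.cast_nonneg (α := ℝ)]
      _ ≤ ((K + 1) * n + k + 1) ^ 2 :=
        le_self_pow₀ (le_add_of_nonneg_left (by positivity)) two_ne_zero

theorem mul_Hmax_le_log_nomial {κ : ℕ∞} {n k : ℕ} (h : 0 < nomial κ n k) :
    n * Hmax κ (k / n) ≤ 2 * Real.log ((κ.toNat + 1) * n + k + 1) + Real.log (nomial κ n k) := by
  have hpos : (1 : ℝ) ≤ nomial κ n k := by exact_mod_cast h
  have hP : (1 : ℝ) ≤ (κ.toNat + 1) * n + k + 1 := le_add_of_nonneg_left (by positivity)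
  have hnonneg := add_nonneg (mul_nonneg zero_le_two (Real.log_nonneg hP)) (Real.log_nonneg hpos)
  obtain rfl | hk := k.eq_zero_or_pos
  · simpa [Hmax_zero] using hnonneg
  obtain rfl | hn := n.eq_zero_or_pos
  · simpa using hnonneg
  obtain ⟨q, hq, hle⟩ := exists_partitionFn_pow_le_sq_mul hn hk h
  have hZ := partitionFn_pos hq
  have hqk := pow_pos hq.1 k
  have hlog := Real.log_le_log (pow_pos hZ n) hle
  rw [Real.log_pow, Real.log_mul (by positivity) (by positivity), Real.log_mul (by positivity)
    hqk.ne', Real.log_pow, Real.log_pow, Nat.cast_two] at hlog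
  calc n * Hmax κ (k / n) ≤ n * potential κ (k / n) q := by
        gcongr
        exact Hmax_le_potential (div_mem_meanRange_of_nomial_pos h) hq
    _ = n * Real.log (partitionFn κ q) - k * Real.log q := by rw [potential]; field_simp
    _ ≤ _ := by linarith

/-! ### Entropy bound on families of vectors -/

theorem sum_prod_geomWeight_le {ι : Type*} [Fintype ι] {κ : ℕ∞} (𝒜 : Finset (ι → ℕ)) {q : ι → ℝ}
    (hq : ∀ i, q i ∈ fugacities κ) :
    ∑ A ∈ 𝒜, ∏ i, geomWeight κ (q i) (A i) ≤ ∏ i, partitionFn κ (q i) := by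
  classical
  have hnonneg : ∀ i t, 0 ≤ geomWeight κ (q i) t := fun i => geomWeight_nonneg κ (hq i).1.le
  set B := 𝒜.sup fun A => Finset.univ.sup A
  have hsub : 𝒜 ⊆ Fintype.piFinset fun _ => Finset.range (B + 1) := fun A hA => by
    refine Fintype.mem_piFinset.2 fun i => Finset.mem_range_succ_iff.2 ?_
    exact (Finset.le_sup (f := A) (Finset.mem_univ i)).trans
      (Finset.le_sup (f := fun A : ι → ℕ => Finset.univ.sup A) hA)
  calc ∑ A ∈ 𝒜, ∏ i, geomWeight κ (q i) (A i)
      ≤ ∑ A ∈ Fintype.piFinset fun _ => Finset.range (B + 1), ∏ i, geomWeight κ (q i) (A i) :=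
        Finset.sum_le_sum_of_subset_of_nonneg hsub fun A _ _ =>
          Finset.prod_nonneg fun i _ => hnonneg i _
    _ = ∏ i, ∑ t ∈ Finset.range (B + 1), geomWeight κ (q i) t := (Finset.prod_univ_sum _ _).symm
    _ ≤ ∏ i, partitionFn κ (q i) :=
        Finset.prod_le_prod (fun i _ => Finset.sum_nonneg fun t _ => hnonneg i t)
          fun i _ => (hq i).2.sum_le_tsum _ fun t _ => hnonneg i t

/-- Jensen's inequality for `log`, applied to the weights `∏ i, q i ^ A i`. -/
theorem log_card_le_sum_potential {ι : Type*} [Fintype ι] {κ : ℕ∞} {𝒜 : Finset (ι → ℕ)}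
    (hne : 𝒜.Nonempty) (h𝒜 : ∀ A ∈ 𝒜, ∀ i, (A i : ℕ∞) ≤ κ) {q : ι → ℝ}
    (hq : ∀ i, q i ∈ fugacities κ) :
    Real.log 𝒜.card ≤ ∑ i, potential κ ((∑ A ∈ 𝒜, (A i : ℝ)) / 𝒜.card) (q i) := by
  set w : (ι → ℕ) → ℝ := fun A => ∏ i, q i ^ A i
  have hw : ∀ A ∈ 𝒜, 0 < w A := fun A _ => Finset.prod_pos fun i _ => pow_pos (hq i).1 _
  have hcard : (0 : ℝ) < 𝒜.card := by exact_mod_cast hne.card_pos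
  have hlogw : ∀ A, Real.log (w A) = ∑ i, A i * Real.log (q i) := fun A => by
    rw [Real.log_prod fun i _ => (pow_pos (hq i).1 _).ne']
    exact Finset.sum_congr rfl fun i _ => Real.log_pow _ _
  have hjensen : (𝒜.card : ℝ)⁻¹ * ∑ A ∈ 𝒜, Real.log (w A) ≤
      Real.log ((𝒜.card : ℝ)⁻¹ * ∑ A ∈ 𝒜, w A) := by
    simpa only [smul_eq_mul, ← Finset.mul_sum] using
      strictConcaveOn_log_Ioi.concaveOn.le_map_sum (t := 𝒜) (w := fun _ => (𝒜.card : ℝ)⁻¹)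
        (fun _ _ => by positivity) (by simp [hcard.ne']) hw
  have hsum : ∑ A ∈ 𝒜, w A ≤ ∏ i, partitionFn κ (q i) :=
    (Finset.sum_congr rfl fun A hA => Finset.prod_congr rfl fun i _ =>
      (geomWeight_of_le _ (h𝒜 A hA i)).symm).trans_le (sum_prod_geomWeight_le 𝒜 hq)
  have hsum_pos : 0 < ∑ A ∈ 𝒜, w A := Finset.sum_pos hw hne
  rw [Real.log_mul (by positivity) hsum_pos.ne', Real.log_inv] at hjensen
  have hlog := Real.log_le_log hsum_pos hsum
  rw [Real.log_prod fun i _ => (partitionFn_pos (hq i)).ne'] at hlog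
  have hmean : ∑ i, (∑ A ∈ 𝒜, (A i : ℝ)) / 𝒜.card * Real.log (q i) =
      (𝒜.card : ℝ)⁻¹ * ∑ A ∈ 𝒜, Real.log (w A) := by
    simp only [hlogw]
    rw [Finset.sum_comm, Finset.mul_sum]
    refine Finset.sum_congr rfl fun i _ => ?_
    rw [← Finset.sum_mul, div_eq_inv_mul, mul_assoc]
  simp only [potential, Finset.sum_sub_distrib]
  rw [hmean]
  linarith

theorem log_card_le_sum_Hmax {ι : Type*} [Fintype ι] {κ : ℕ∞} {𝒜 : Finset (ι → ℕ)}
    (h𝒜 : ∀ A ∈ 𝒜, ∀ i, (A i : ℕ∞) ≤ κ) :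
    Real.log 𝒜.card ≤ ∑ i, Hmax κ ((∑ A ∈ 𝒜, (A i : ℝ)) / 𝒜.card) := by
  obtain rfl | hne := 𝒜.eq_empty_or_nonempty
  · simp [Hmax_zero]
  refine le_of_forall_pos_le_add fun ε hε => ?_
  have hmean : ∀ i, (∑ A ∈ 𝒜, (A i : ℝ)) / 𝒜.card ∈ meanRange κ := fun i =>
    average_mem_meanRange fun A hA => natCast_mem_meanRange.2 (h𝒜 A hA i)
  have hδ : 0 < ε / (Fintype.card ι + 1) := by positivity
  choose q hq hlt using fun i => exists_potential_lt (hmean i) hδ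
  calc Real.log 𝒜.card ≤ ∑ i, potential κ ((∑ A ∈ 𝒜, (A i : ℝ)) / 𝒜.card) (q i) :=
        log_card_le_sum_potential hne h𝒜 hq
    _ ≤ ∑ i, (Hmax κ ((∑ A ∈ 𝒜, (A i : ℝ)) / 𝒜.card) + ε / (Fintype.card ι + 1)) :=
        Finset.sum_le_sum fun i _ => (hlt i).le
    _ = (∑ i, Hmax κ ((∑ A ∈ 𝒜, (A i : ℝ)) / 𝒜.card)) +
          Fintype.card ι / (Fintype.card ι + 1) * ε := by
        rw [Finset.sum_add_distrib, Finset.sum_const, Finset.card_univ, nsmul_eq_mul]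
        ring
    _ ≤ _ := by
        gcongr
        exact mul_le_of_le_one_left hε.le (div_le_one_of_le₀ (by linarith) (by positivity))

theorem log_nomial_le (κ : ℕ∞) (n k : ℕ) :
    Real.log (nomial κ n k) ≤ n * Hmax κ (k / n) := by
  obtain h0 | h0 := Nat.eq_zero_or_pos (nomial κ n k)
  · rw [h0, Nat.cast_zero, Real.log_zero]
    exact mul_nonneg n.cast_nonneg (Hmax_nonneg κ _)
  rw [← card_boundedVectors_fin] at h0 ⊢
  have hκ : ∀ u ∈ boundedVectors κ (Fin n) k, ∀ i, (u i : ℕ∞) ≤ κ :=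
    fun u hu => (mem_boundedVectors.1 hu).1
  have hsum : ∑ i, (∑ u ∈ boundedVectors κ (Fin n) k, (u i : ℝ)) /
      (boundedVectors κ (Fin n) k).card = k :=
    sum_average_eq (Finset.card_pos.1 h0) fun u hu => by exact_mod_cast (mem_boundedVectors.1 hu).2
  refine (log_card_le_sum_Hmax hκ).trans ((sum_Hmax_le fun i =>
    average_mem_meanRange fun u hu => natCast_mem_meanRange.2 (hκ u hu i)).trans_eq ?_)
  rw [hsum, Fintype.card_fin]

theorem tendsto_log_mul_add_one_div {c : ℝ} (hc : 0 ≤ c) :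
    Tendsto (fun t : ℕ => Real.log (c * t + 1) / t) atTop (𝓝 0) := by
  have hlog : Tendsto (fun t : ℕ => Real.log t / t) atTop (𝓝 0) :=
    Real.isLittleO_log_id_atTop.tendsto_div_nhds_zero.comp tendsto_natCast_atTop_atTop
  have hupper := (tendsto_const_div_atTop_nhds_zero_nat (Real.log (c + 1))).add hlog
  rw [add_zero] at hupper
  refine squeeze_zero' (Eventually.of_forall fun t => ?_) ?_ hupper
  · exact div_nonneg (Real.log_nonneg (le_add_of_nonneg_left (by positivity))) t.cast_nonneg
  · filter_upwards [eventually_ge_atTop 1] with t ht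
    have ht1 : (1 : ℝ) ≤ t := by exact_mod_cast ht
    rw [← add_div, ← Real.log_mul (by positivity) (by positivity)]
    gcongr
    linarith

theorem tendsto_log_nomial_mul {κ : ℕ∞} {a k : ℕ} (h : 0 < nomial κ a k) :
    Tendsto (fun t : ℕ => Real.log (nomial κ (t * a) (t * k)) / t) atTop
      (𝓝 (a * Hmax κ (k / a))) := by
  set c : ℝ := (κ.toNat + 1) * a + k
  have hlower : Tendsto (fun t : ℕ => a * Hmax κ (k / a) - 2 * (Real.log (c * t + 1) / t)) atTop
      (𝓝 (a * Hmax κ (k / a))) := by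
    simpa using tendsto_const_nhds.sub
      ((tendsto_log_mul_add_one_div (c := c) (by positivity)).const_mul 2)
  have hmean : ∀ {t : ℕ}, 1 ≤ t → ((t * k : ℕ) / (t * a : ℕ) : ℝ) = k / a := fun {t} ht => by
    have : (t : ℝ) ≠ 0 := by exact_mod_cast (Nat.one_le_iff_ne_zero.1 ht)
    push_cast
    exact mul_div_mul_left _ _ this
  refine tendsto_of_tendsto_of_tendsto_of_le_of_le' hlower tendsto_const_nhds ?_ ?_
  · filter_upwards [eventually_ge_atTop 1] with t ht
    have ht0 : (0 : ℝ) < t := by exact_mod_cast ht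
    have hle := mul_Hmax_le_log_nomial (nomial_mul_pos h t)
    rw [hmean ht, show (κ.toNat + 1) * ((t * a : ℕ) : ℝ) + (t * k : ℕ) + 1 = c * t + 1 by
      push_cast; ring] at hle
    rw [le_div_iff₀ ht0, sub_mul, mul_assoc 2, div_mul_cancel₀ _ ht0.ne']
    push_cast at hle
    linarith
  · filter_upwards [eventually_ge_atTop 1] with t ht
    have ht0 : (0 : ℝ) < t := by exact_mod_cast ht
    have hle := log_nomial_le κ (t * a) (t * k)
    rw [hmean ht] at hle
    rw [div_le_iff₀ ht0]
    push_cast at hle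
    linarith

/-! ### Block decompositions of tables -/

section IndexedTables

variable {α β ι ι' σ τ : Type*} [Fintype α] [Fintype β] [Fintype ι] [Fintype ι'] [Fintype σ]
  [Fintype τ] {κ : ℕ∞}

/-- Contingency tables with arbitrary finite index types, so that block decompositions of cloned
tables become products of index types. -/
def tablesOn (κ : ℕ∞) (R : ι → ℕ) (C : ι' → ℕ) : Set (Matrix ι ι' ℕ) :=
  {A | (∀ i j, (A i j : ℕ∞) ≤ κ) ∧ (∀ i, ∑ j, A i j = R i) ∧ (∀ j, ∑ i, A i j = C j)}

/-- The number of contingency tables with arbitrary finite index types. -/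
def cardTables (κ : ℕ∞) (R : ι → ℕ) (C : ι' → ℕ) : ℕ := Nat.card (tablesOn κ R C)

theorem cardTables_eq_numTables {m n : ℕ} (κ : ℕ∞) (R : Fin m → ℕ) (C : Fin n → ℕ) :
    cardTables κ R C = numTables κ R C :=
  rfl

instance finite_tablesOn (κ : ℕ∞) (R : ι → ℕ) (C : ι' → ℕ) : Finite (tablesOn κ R C) := by
  refine ((Set.Finite.pi' fun i => Set.Finite.pi' fun _ : ι' => Set.finite_Iic (R i)).subset
    fun A hA i j => ?_).to_subtype
  rw [Set.mem_Iic, ← hA.2.1 i]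
  exact Finset.single_le_sum (f := fun j => A i j) (fun _ _ => Nat.zero_le _) (Finset.mem_univ j)

theorem cardTables_comp_equiv (R : ι → ℕ) (C : ι' → ℕ) (e : σ ≃ ι) (f : τ ≃ ι') :
    cardTables κ (R ∘ e) (C ∘ f) = cardTables κ R C := by
  refine Nat.card_congr ((Matrix.reindex e f).subtypeEquiv fun A => ?_)
  have hcol (j : τ) : ∑ i, A (e.symm i) j = ∑ i, A i j := e.symm.sum_comp (A · j)
  simp only [tablesOn, Set.mem_ofPred_eq, Matrix.reindex_apply, Matrix.submatrix_apply,
    Function.comp_apply]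
  rw [e.symm.forall_congr_left, e.symm.forall_congr_left, f.symm.forall_congr_left]
  simp only [f.symm.forall_congr_left, Equiv.symm_symm, Equiv.symm_apply_apply,
    f.symm.sum_comp (A _), hcol]

theorem numTables_clone {m n s : ℕ} (hσ : Fintype.card σ = s) (R : Fin m → ℕ) (C : Fin n → ℕ) :
    numTables κ (clone s R) (clone s C) =
      cardTables κ (fun x : σ × Fin m => s * R x.2) (fun y : σ × Fin n => s * C y.2) := by
  let e (k : ℕ) : σ × Fin k ≃ Fin (s * k) :=
    ((Fintype.equivFinOfCardEq hσ).prodCongr (Equiv.refl _)).trans finProdFinEquiv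
  have he {k : ℕ} (x : σ × Fin k) : (e k x).modNat = x.2 :=
    congrArg Prod.snd (finProdFinEquiv.symm_apply_apply (Fintype.equivFinOfCardEq hσ x.1, x.2))
  rw [← cardTables_eq_numTables, ← cardTables_comp_equiv _ _ (e m) (e n)]
  simp only [Function.comp_def, clone, he]

/-- Assemble a table from independent blocks. -/
theorem prod_cardTables_le (R : α → β → ι → ℕ) (C : α → β → ι' → ℕ) :
    ∏ a, ∏ b, cardTables κ (R a b) (C a b) ≤
      cardTables κ (fun x : α × ι => ∑ b, R x.1 b x.2) (fun y : β × ι' => ∑ a, C a y.1 y.2) := by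
  simp only [cardTables, ← Nat.card_pi]
  refine Nat.card_le_card_of_injective
    (fun A => ⟨fun x y => (A x.1 y.1).1 x.2 y.2, fun x y => (A x.1 y.1).2.1 x.2 y.2,
      fun x => ?_, fun y => ?_⟩) fun A B h => ?_
  · rw [Fintype.sum_prod_type]
    exact Finset.sum_congr rfl fun b _ => (A x.1 b).2.2.1 x.2
  · rw [Fintype.sum_prod_type]
    exact Finset.sum_congr rfl fun a _ => (A a y.1).2.2.2 y.2
  · funext a b
    ext i j
    exact congrFun₂ (congrArg Subtype.val h) (a, i) (b, j)

theorem numTables_clone_pow_le {m n : ℕ} (R : Fin m → ℕ) (C : Fin n → ℕ) (k s : ℕ) :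
    numTables κ (clone s R) (clone s C) ^ (k ^ 2) ≤
      numTables κ (clone (k * s) R) (clone (k * s) C) := by
  have h := prod_cardTables_le (κ := κ) (α := Fin k) (β := Fin k)
    (fun _ _ => fun x : Fin s × Fin m => s * R x.2) (fun _ _ => fun y : Fin s × Fin n => s * C y.2)
  simp only [Finset.prod_const, Finset.sum_const, Finset.card_univ, Fintype.card_fin, smul_eq_mul,
    ← pow_mul, ← numTables_clone (Fintype.card_fin s), ← sq] at h
  refine h.trans_eq ?_
  rw [numTables_clone (σ := Fin k × Fin s) (by simp), ← cardTables_comp_equiv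
    (e := (Equiv.prodAssoc _ _ _).symm) (f := (Equiv.prodAssoc _ _ _).symm)]
  simp only [Function.comp_def, Equiv.prodAssoc_symm_apply, mul_assoc]

/-- Fill the new cells with copies of a fixed table. -/
theorem numTables_clone_le_add {m n : ℕ} {R : Fin m → ℕ} {C : Fin n → ℕ}
    (hT : 0 < numTables κ R C) (s r : ℕ) :
    numTables κ (clone s R) (clone s C) ≤ numTables κ (clone (s + r) R) (clone (s + r) C) := by
  obtain ⟨A, hAκ, hAR, hAC⟩ := (Set.ncard_pos (finite_tables κ R C)).1 hT
  rw [numTables_clone (Fintype.card_fin s), numTables_clone (σ := Fin s ⊕ Fin r) (by simp)]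
  refine Nat.card_le_card_of_injective
    (fun B => ⟨fun x y => x.1.elim (fun a => y.1.elim (fun b => B.1 (a, x.2) (b, y.2))
      fun _ => A x.2 y.2) fun _ => A x.2 y.2, ?_, ?_, ?_⟩) fun B B' h => ?_
  · rintro ⟨a | a, i⟩ ⟨_ | _, j⟩
    exacts [B.2.1 _ _, hAκ i j, hAκ i j, hAκ i j]
  · have hB := fun x => B.2.2.1 x
    simp only [Fintype.sum_prod_type] at hB
    rintro ⟨_ | _, i⟩ <;> simp [Fintype.sum_prod_type, hB, hAR, add_mul]
  · have hB := fun y => B.2.2.2 y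
    simp only [Fintype.sum_prod_type] at hB
    rintro ⟨_ | _, j⟩ <;> simp [Fintype.sum_prod_type, hB, hAC, add_mul]
  · ext ⟨a, i⟩ ⟨b, j⟩
    exact congrFun₂ (congrArg Subtype.val h) (Sum.inl a, i) (Sum.inl b, j)

/-- Shifting the columns of the block `(a, b)` by `a` makes all column sums equal. -/
theorem cardTables_pow_le {G : Type*} [AddGroup G] [Fintype G] {c : ℕ} (R : ι → ℕ) {C : G → ℕ}
    (hC : ∑ g, C g = Fintype.card G * c) :
    cardTables κ R C ^ (Fintype.card G ^ 2) ≤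
      cardTables κ (fun x : G × ι => Fintype.card G * R x.2)
        (fun _ : G × G => Fintype.card G * c) := by
  have hshift (a : G) : cardTables κ R (fun g => C (a + g)) = cardTables κ R C :=
    cardTables_comp_equiv R C (Equiv.refl ι) (Equiv.addLeft a)
  have hsum (g : G) : ∑ a, C (a + g) = Fintype.card G * c :=
    (Equiv.sum_comp (Equiv.addRight g) C).trans hC
  have h := prod_cardTables_le (κ := κ) (β := G) (fun _ _ => R) fun a _ g => C (a + g)
  simpa only [hshift, hsum, Finset.prod_const, Finset.sum_const, Finset.card_univ, smul_eq_mul,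
    ← pow_mul, ← sq] using h

/-- Pigeonhole: the tables whose rows are arbitrary vectors of sum `c` have few vectors of column
sums. -/
theorem exists_nomial_pow_le_cardTables (κ : ℕ∞) (ι ι' : Type*) [Fintype ι] [Fintype ι']
    [Nonempty ι'] (c : ℕ) : ∃ C : ι' → ℕ, ∑ j, C j = Fintype.card ι * c ∧
      nomial κ (Fintype.card ι') c ^ Fintype.card ι ≤
        (Fintype.card ι * c + 1) ^ Fintype.card ι' * cardTables κ (fun _ : ι => c) C := by
  classical
  set N := Fintype.card ι * c
  set rows := Fintype.piFinset fun _ : ι => boundedVectors κ ι' c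
  set sums := boundedVectors ⊤ ι' N
  have hrow {A : ι → ι' → ℕ} (hA : A ∈ rows) (i : ι) :
      (∀ j, (A i j : ℕ∞) ≤ κ) ∧ ∑ j, A i j = c :=
    mem_boundedVectors.1 (Fintype.mem_piFinset.1 hA i)
  have hmaps : ∀ A ∈ rows, (fun j => ∑ i, A i j) ∈ sums := fun A hA =>
    mem_boundedVectors.2 ⟨fun _ => le_top, by rw [Finset.sum_comm]; simp [N, (hrow hA _).2]⟩
  have hsums : sums.Nonempty :=
    ⟨Pi.single (Classical.arbitrary ι') N, mem_boundedVectors.2 ⟨fun _ => le_top, by simp⟩⟩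
  obtain ⟨C, hC, hmax⟩ := sums.exists_max_image
    (fun C => {A ∈ rows | (fun j => ∑ i, A i j) = C}.card) hsums
  have hfiber : {A ∈ rows | (fun j => ∑ i, A i j) = C}.card ≤ cardTables κ (fun _ : ι => c) C := by
    rw [cardTables, Nat.card_coe_set_eq, ← Set.ncard_coe_finset]
    refine Set.ncard_le_ncard (fun A hA => ?_) (Set.toFinite (tablesOn κ (fun _ : ι => c) C))
    rw [Finset.mem_coe, Finset.mem_filter] at hA
    exact ⟨fun i => (hrow hA.1 i).1, fun i => (hrow hA.1 i).2, congrFun hA.2⟩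
  have hsums_card : sums.card ≤ (N + 1) ^ Fintype.card ι' :=
    (card_boundedVectors _ _ _).trans_le (nomial_le_pow _ _ _)
  refine ⟨C, (mem_boundedVectors.1 hC).2, ?_⟩
  calc nomial κ (Fintype.card ι') c ^ Fintype.card ι = rows.card := by
        simp [rows, card_boundedVectors]
    _ ≤ {A ∈ rows | (fun j => ∑ i, A i j) = C}.card * sums.card :=
        Finset.card_le_mul_card_image_of_maps_to hmaps _ hmax
    _ ≤ _ := (Nat.mul_le_mul hfiber hsums_card).trans_eq (mul_comm _ _)

theorem nomial_pow_le_cardTables (κ : ℕ∞) {h : ℕ} (hh : 0 < h) (c : ℕ) :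
    nomial κ h c ^ h ^ 3 ≤ (h * c + 1) ^ h ^ 3 *
      cardTables κ (fun _ : Fin h × Fin h => h * c) (fun _ : Fin h × Fin h => h * c) := by
  have : NeZero h := ⟨hh.ne'⟩
  obtain ⟨C, hC, hle⟩ := exists_nomial_pow_le_cardTables κ (Fin h) (Fin h) c
  have hpow := cardTables_pow_le (κ := κ) (fun _ : Fin h => c) hC
  simp only [Fintype.card_fin] at hle hpow
  calc nomial κ h c ^ h ^ 3 = (nomial κ h c ^ h) ^ h ^ 2 := by rw [← pow_mul, ← pow_succ']
    _ ≤ ((h * c + 1) ^ h * cardTables κ (fun _ : Fin h => c) C) ^ h ^ 2 :=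
        Nat.pow_le_pow_left hle _
    _ = (h * c + 1) ^ h ^ 3 * cardTables κ (fun _ : Fin h => c) C ^ h ^ 2 := by
        rw [mul_pow, ← pow_mul, ← pow_succ']
    _ ≤ _ := Nat.mul_le_mul_left _ hpow

theorem prod_cardTables_le_numTables_clone {m n h : ℕ} {R : Fin m → ℕ} {C : Fin n → ℕ}
    {c : Matrix (Fin m) (Fin n) ℕ} (hR : ∀ i, ∑ j, c i j = h * R i)
    (hC : ∀ j, ∑ i, c i j = h * C j) :
    ∏ i, ∏ j, cardTables κ (fun _ : Fin h × Fin h => h * c i j)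
        (fun _ : Fin h × Fin h => h * c i j) ≤
      numTables κ (clone (h ^ 2) R) (clone (h ^ 2) C) := by
  refine (prod_cardTables_le _ _).trans_eq ?_
  rw [numTables_clone (σ := Fin h × Fin h) (by simp [sq]), ← cardTables_comp_equiv
    (e := Equiv.prodComm _ _) (f := Equiv.prodComm _ _)]
  simp only [← Finset.mul_sum, hR, hC, Function.comp_def, Equiv.prodComm_apply, Prod.fst_swap, sq,
    mul_assoc]

end IndexedTables

/-! ### Rational points of the transportation polytope -/

section Polytope

variable {m n : ℕ} {κ : ℕ∞} {R : Fin m → ℕ} {C : Fin n → ℕ}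

theorem mem_polytope_iff {Z : Matrix (Fin m) (Fin n) ℝ} :
    Z ∈ polytope κ R C ↔
      (∀ i j, Z i j ∈ meanRange κ) ∧ (∀ i, ∑ j, Z i j = R i) ∧ ∀ j, ∑ i, Z i j = C j :=
  ⟨fun h => ⟨fun i j => ⟨h.1 i j, fun k hk => h.2.1 k hk i j⟩, h.2.2⟩,
    fun h => ⟨fun i j => (h.1 i j).1, fun k hk i j => (h.1 i j).2 k hk, h.2⟩⟩

theorem polytope_nonempty (hT : 0 < numTables κ R C) : (polytope κ R C).Nonempty := by
  obtain ⟨A, hA⟩ := (Set.ncard_pos (finite_tables κ R C)).1 hT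
  exact ⟨_, (mem_tables_iff κ R C A).1 hA⟩

theorem isClosed_meanRange (κ : ℕ∞) : IsClosed (meanRange κ) := by
  simp only [meanRange, Set.ofPred_and, Set.ofPred_forall]
  exact isClosed_Ici.inter (isClosed_iInter fun _ => isClosed_iInter fun _ => isClosed_Iic)

theorem isCompact_polytope (κ : ℕ∞) (R : Fin m → ℕ) (C : Fin n → ℕ) :
    IsCompact (polytope κ R C) := by
  have hbox : IsCompact {Z : Fin m → Fin n → ℝ | ∀ i j, Z i j ∈ Set.Icc (0 : ℝ) (R i)} :=
    isCompact_pi_infinite fun i => isCompact_pi_infinite fun _ => isCompact_Icc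
  have hclosed : IsClosed {Z : Fin m → Fin n → ℝ | (∀ i j, Z i j ∈ meanRange κ) ∧
      (∀ i, ∑ j, Z i j = R i) ∧ ∀ j, ∑ i, Z i j = C j} := by
    simp only [Set.ofPred_and, Set.ofPred_forall]
    refine (isClosed_iInter fun i => isClosed_iInter fun j =>
      (isClosed_meanRange κ).preimage (by fun_prop)).inter (IsClosed.inter ?_ ?_)
    · exact isClosed_iInter fun i => isClosed_eq (by fun_prop) continuous_const
    · exact isClosed_iInter fun j => isClosed_eq (by fun_prop) continuous_const
  have hZ : polytope κ R C = {Z : Fin m → Fin n → ℝ | (∀ i j, Z i j ∈ meanRange κ) ∧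
      (∀ i, ∑ j, Z i j = R i) ∧ ∀ j, ∑ i, Z i j = C j} := Set.ext fun _ => mem_polytope_iff
  refine hbox.of_isClosed_subset (hZ ▸ hclosed) fun Z hZ i j => ⟨hZ.1 i j, ?_⟩
  rw [← hZ.2.2.1 i]
  exact Finset.single_le_sum (f := fun j => Z i j) (fun j _ => hZ.1 i j) (Finset.mem_univ j)

theorem continuousOn_sum_Hmax (κ : ℕ∞) (R : Fin m → ℕ) (C : Fin n → ℕ) :
    ContinuousOn (fun Z : Matrix (Fin m) (Fin n) ℝ => ∑ i, ∑ j, Hmax κ (Z i j))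
      (polytope κ R C) :=
  continuousOn_finsetSum _ fun i _ => continuousOn_finsetSum _ fun j _ =>
    (continuousOn_Hmax κ).comp (f := fun Z : Matrix (Fin m) (Fin n) ℝ => Z i j)
      (continuous_id.matrix_elem i j).continuousOn fun _ hZ => (mem_polytope_iff.1 hZ).1 i j

/-- The maps send `v` to the rational approximations of `v` for every `v` in a basis of `ℝ` over `ℚ`
containing `1`. Since they respect linear equations with integer coefficients, they approximate a
point of a transportation polytope within the polytope. -/
theorem exists_tendsto_rat_linearMap : ∃ φ : ℕ → ℝ →ₗ[ℚ] ℚ, (∀ t, φ t 1 = 1) ∧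
    ∀ x, Tendsto (fun t => (φ t x : ℝ)) atTop (𝓝 x) := by
  classical
  have hli : LinearIndepOn ℚ id ({1} : Set ℝ) := (linearIndepOn_singleton_iff _).2 one_ne_zero
  let b := Module.Basis.extend hli
  have hb (v) : b v = v := Module.Basis.extend_apply_self hli v
  have hseq (v : ℝ) : ∃ r : ℕ → ℚ, Tendsto (fun t => (r t : ℝ)) atTop (𝓝 v) ∧
      (v = 1 → ∀ t, r t = 1) := by
    obtain rfl | hv := eq_or_ne v 1
    · exact ⟨fun _ => 1, by simp, fun _ _ => rfl⟩
    · obtain ⟨r, -, -, hr⟩ := Real.exists_seq_rat_strictMono_tendsto v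
      exact ⟨r, hr, fun h => absurd h hv⟩
  choose r hr hr1 using hseq
  have hφb (t : ℕ) (v : hli.extend (Set.subset_univ _)) :
      b.constr ℚ (fun v => r v t) (v : ℝ) = r v t := by
    rw [← hb v, b.constr_basis, hb]
  refine ⟨fun t => b.constr ℚ fun v => r v t, fun t => ?_, fun x => ?_⟩
  · exact (hφb t ⟨1, hli.subset_extend _ rfl⟩).trans (hr1 1 rfl t)
  · induction b.mem_span x using Submodule.span_induction with
    | mem x hx =>
      obtain ⟨v, rfl⟩ := hx
      simpa only [hb, hφb] using hr v
    | zero => simp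
    | add x y _ _ hx hy => simpa using hx.add hy
    | smul q x _ hx =>
      simp only [map_smul, smul_eq_mul, Rat.cast_mul]
      rw [Rat.smul_def]
      exact hx.const_mul (q : ℝ)

theorem mem_closure_rat_polytope {Z : Matrix (Fin m) (Fin n) ℝ} (hZ : Z ∈ polytope κ R C) :
    Z ∈ closure {Y ∈ polytope κ R C | ∃ W : Matrix (Fin m) (Fin n) ℚ, Y = W.map (↑)} := by
  obtain ⟨φ, hφ1, hφ⟩ := exists_tendsto_rat_linearMap
  have hnat (t a : ℕ) : φ t a = a := by
    simpa [hφ1, Rat.smul_def] using (φ t).map_smul (a : ℚ) 1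
  have hmem {x : ℝ} (hx : x ∈ meanRange κ) : ∀ᶠ t in atTop, (φ t x : ℝ) ∈ meanRange κ := by
    refine Filter.Eventually.and ?_ ?_
    · obtain h | h := hx.1.eq_or_lt
      · simp [← h]
      · exact ((hφ x).eventually_const_lt h).mono fun _ => le_of_lt
    · induction κ using ENat.recTopCoe with
      | top => simp
      | coe K =>
        obtain h | h := (hx.2 K rfl).eq_or_lt
        · simp [h, hnat]
        · filter_upwards [(hφ x).eventually_lt_const h] with t ht k hk
          exact ENat.natCast_inj.1 hk ▸ ht.le
  refine mem_closure_of_tendsto (f := fun t => (Matrix.of fun i j => φ t (Z i j)).map (↑))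
    (b := atTop) (tendsto_pi_nhds.2 fun i => tendsto_pi_nhds.2 fun j => hφ (Z i j)) ?_
  rw [mem_polytope_iff] at hZ
  filter_upwards [eventually_all.2 fun i => eventually_all.2 fun j => hmem (hZ.1 i j)] with t ht
  refine ⟨mem_polytope_iff.2 ⟨ht, fun i => ?_, fun j => ?_⟩, _, rfl⟩
  · have h := congrArg (φ t) (hZ.2.1 i)
    rw [map_sum, hnat] at h
    simpa using congrArg ((↑) : ℚ → ℝ) h
  · have h := congrArg (φ t) (hZ.2.2 j)
    rw [map_sum, hnat] at h
    simpa using congrArg ((↑) : ℚ → ℝ) h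

theorem exists_natCast_eq_mul {ι : Type*} [Finite ι] {x : ι → ℚ} (hx : ∀ i, 0 ≤ x i) :
    ∃ d : ℕ, 0 < d ∧ ∀ i, ∃ v : ℕ, (v : ℚ) = d * x i := by
  cases nonempty_fintype ι
  refine ⟨∏ i, (x i).den, Finset.prod_pos fun i _ => (x i).den_pos, fun i => ?_⟩
  obtain ⟨c, hc⟩ := Finset.dvd_prod_of_mem (fun i => (x i).den) (Finset.mem_univ i)
  refine ⟨(x i).num.toNat * c, ?_⟩
  have hnum : ((x i).num.toNat : ℚ) = x i * (x i).den := by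
    rw [Rat.mul_den_eq_num]
    exact_mod_cast Int.toNat_of_nonneg (Rat.num_nonneg.2 (hx i))
  rw [hc]
  push_cast
  rw [hnum]
  ring

end Polytope

/-! ### Asymptotics for cloned tables -/

section MeanTable

variable {ι ι' : Type*} [Fintype ι] [Fintype ι'] {κ : ℕ∞} {R : ι → ℕ} {C : ι' → ℕ}

open Classical in
/-- The entrywise average of all contingency tables with the given margins, and `0` if there
are none. -/
def meanTable (κ : ℕ∞) (R : ι → ℕ) (C : ι' → ℕ) : Matrix ι ι' ℝ := fun i j =>
  (∑ A ∈ (Set.toFinite (tablesOn κ R C)).toFinset, (A i j : ℝ)) /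
    (Set.toFinite (tablesOn κ R C)).toFinset.card

theorem cardTables_eq_card_toFinset :
    cardTables κ R C = (Set.toFinite (tablesOn κ R C)).toFinset.card :=
  (Nat.card_coe_set_eq _).trans (Set.ncard_eq_toFinset_card _ (Set.toFinite _))

theorem meanTable_mem_meanRange (i : ι) (j : ι') : meanTable κ R C i j ∈ meanRange κ :=
  average_mem_meanRange fun _ hA =>
    natCast_mem_meanRange.2 (((Set.Finite.mem_toFinset _).1 hA).1 i j)

theorem sum_meanTable_row (h : 0 < cardTables κ R C) (i : ι) :
    ∑ j, meanTable κ R C i j = R i := by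
  rw [cardTables_eq_card_toFinset, Finset.card_pos] at h
  exact sum_average_eq h fun A hA => by
    exact_mod_cast ((Set.Finite.mem_toFinset _).1 hA).2.1 i

theorem sum_meanTable_col (h : 0 < cardTables κ R C) (j : ι') :
    ∑ i, meanTable κ R C i j = C j := by
  rw [cardTables_eq_card_toFinset, Finset.card_pos] at h
  exact sum_average_eq h fun A hA => by
    exact_mod_cast ((Set.Finite.mem_toFinset _).1 hA).2.2 j

theorem log_cardTables_le (κ : ℕ∞) (R : ι → ℕ) (C : ι' → ℕ) :
    Real.log (cardTables κ R C) ≤ ∑ i, ∑ j, Hmax κ (meanTable κ R C i j) := by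
  let e : Matrix ι ι' ℕ ↪ (ι × ι' → ℕ) := ⟨Function.uncurry, Function.uncurry_injective⟩
  have h := log_card_le_sum_Hmax (κ := κ) (𝒜 := (Set.toFinite (tablesOn κ R C)).toFinset.map e)
    (Finset.forall_mem_map.2 fun A hA p => ((Set.Finite.mem_toFinset _).1 hA).1 p.1 p.2)
  simp only [Finset.card_map, Finset.sum_map, Fintype.sum_prod_type] at h
  rw [cardTables_eq_card_toFinset]
  exact h

end MeanTable

section Clones

variable {m n : ℕ} {κ : ℕ∞} {R : Fin m → ℕ} {C : Fin n → ℕ}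

theorem numTables_clone_pos (hT : 0 < numTables κ R C) (s : ℕ) :
    0 < numTables κ (clone s R) (clone s C) := by
  have h : 0 < numTables κ (clone 0 R) (clone 0 C) := by
    simpa [Nat.one_le_iff_ne_zero, pos_iff_ne_zero] using numTables_clone_pow_le (κ := κ) R C 0 0
  exact zero_add s ▸ h.trans_le (numTables_clone_le_add hT 0 s)

theorem exists_log_numTables_clone_le (hT : 0 < numTables κ R C) {s : ℕ} (hs : 0 < s) :
    ∃ Z ∈ polytope κ R C, Real.log (numTables κ (clone s R) (clone s C)) ≤
      s ^ 2 * ∑ i, ∑ j, Hmax κ (Z i j) := by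
  have hpos := numTables_clone_pos hT s
  have hs0 : (s : ℝ) ≠ 0 := by exact_mod_cast hs.ne'
  rw [numTables_clone (Fintype.card_fin s)] at hpos ⊢
  set W := meanTable κ (fun x : Fin s × Fin m => s * R x.2) (fun y : Fin s × Fin n => s * C y.2)
  have hW (x y) : W x y ∈ meanRange κ := meanTable_mem_meanRange x y
  have hrow (a i) : ∑ b, ∑ j, W (a, i) (b, j) = s * R i := by
    rw [← Fintype.sum_prod_type']
    exact_mod_cast sum_meanTable_row hpos (a, i)
  have hcol (b j) : ∑ a, ∑ i, W (a, i) (b, j) = s * C j := by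
    rw [← Fintype.sum_prod_type']
    exact_mod_cast sum_meanTable_col hpos (b, j)
  refine ⟨fun i j => (∑ p : Fin s × Fin s, W (p.1, i) (p.2, j)) / s ^ 2,
    mem_polytope_iff.2 ⟨fun i j => ?_, fun i => ?_, fun j => ?_⟩, ?_⟩
  · have h := average_mem_meanRange (s := Finset.univ) fun (p : Fin s × Fin s) _ =>
      hW (p.1, i) (p.2, j)
    simpa [sq] using h
  · rw [← Finset.sum_div, Finset.sum_comm, Fintype.sum_prod_type, div_eq_iff (by positivity)]
    simp only [hrow, Finset.sum_const, Finset.card_univ, Fintype.card_fin, nsmul_eq_mul]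
    ring
  · rw [← Finset.sum_div, Finset.sum_comm, Fintype.sum_prod_type_right, div_eq_iff (by positivity)]
    simp only [hcol, Finset.sum_const, Finset.card_univ, Fintype.card_fin, nsmul_eq_mul]
    ring
  · calc _ ≤ ∑ x, ∑ y, Hmax κ (W x y) := log_cardTables_le κ _ _
      _ = ∑ i, ∑ j, ∑ p : Fin s × Fin s, Hmax κ (W (p.1, i) (p.2, j)) := by
          rw [Fintype.sum_prod_type_right]
          refine Finset.sum_congr rfl fun i _ => ?_
          simp only [Fintype.sum_prod_type_right]
          rw [Finset.sum_comm]
          exact Finset.sum_congr rfl fun j _ => Finset.sum_comm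
      _ ≤ ∑ i, ∑ j, s ^ 2 * Hmax κ ((∑ p : Fin s × Fin s, W (p.1, i) (p.2, j)) / s ^ 2) := by
          gcongr with i _ j
          simpa [sq] using sum_Hmax_le fun p : Fin s × Fin s => hW (p.1, i) (p.2, j)
      _ = _ := by simp only [Finset.mul_sum]

theorem exists_le_sum_eq {K : ℕ} (a : ℕ) {k : ℕ} (hk : k ≤ a * K) :
    ∃ u : Fin a → ℕ, (∀ i, u i ≤ K) ∧ ∑ i, u i = k := by
  induction a generalizing k with
  | zero => exact ⟨0, by simp, by simp_all⟩
  | succ a ih =>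
    rw [add_mul, one_mul] at hk
    obtain ⟨u, hu, hsum⟩ := ih (k := k - min k K) (by omega)
    refine ⟨Fin.cons (min k K) u, Fin.cases (min_le_right k K) hu, ?_⟩
    rw [Fin.sum_cons, hsum]
    omega

theorem nomial_pos_of_div_mem_meanRange {d v : ℕ} (hd : 0 < d)
    (h : (v / d : ℝ) ∈ meanRange κ) : 0 < nomial κ d v := by
  obtain ⟨K, hK, hv⟩ : ∃ K : ℕ, (K : ℕ∞) ≤ κ ∧ v ≤ d * K := by
    induction κ using ENat.recTopCoe with
    | top => exact ⟨v, le_top, Nat.le_mul_of_pos_left v hd⟩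
    | coe K =>
      refine ⟨K, le_rfl, ?_⟩
      have hK := (div_le_iff₀' (by exact_mod_cast hd)).1 (h.2 K rfl)
      exact_mod_cast hK
  obtain ⟨u, hu, hsum⟩ := exists_le_sum_eq d hv
  rw [← Fintype.card_fin d, nomial_pos_iff]
  exact ⟨u, fun i => le_trans (by exact_mod_cast hu i) hK, hsum⟩

theorem cardTables_square_pos {h c : ℕ} (hh : 0 < h) (hc : 0 < nomial κ h c) :
    0 < cardTables κ (fun _ : Fin h × Fin h => h * c) (fun _ : Fin h × Fin h => h * c) :=
  Nat.pos_of_mul_pos_left ((pow_pos hc (h ^ 3)).trans_le (nomial_pow_le_cardTables κ hh c))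

theorem mul_log_nomial_sub_le_log_cardTables {h c : ℕ} (hh : 0 < h) (hc : 0 < nomial κ h c) :
    (h : ℝ) ^ 3 * (Real.log (nomial κ h c) - Real.log (h * c + 1)) ≤
      Real.log (cardTables κ (fun _ : Fin h × Fin h => h * c)
        (fun _ : Fin h × Fin h => h * c)) := by
  have hle : (nomial κ h c : ℝ) ^ h ^ 3 ≤ (h * c + 1 : ℝ) ^ h ^ 3 *
      cardTables κ (fun _ : Fin h × Fin h => h * c) (fun _ : Fin h × Fin h => h * c) := by
    exact_mod_cast nomial_pow_le_cardTables κ hh c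
  have hlog := Real.log_le_log (pow_pos (by exact_mod_cast hc) _) hle
  rw [Real.log_mul (by positivity) (by exact_mod_cast (cardTables_square_pos hh hc).ne'),
    Real.log_pow, Real.log_pow] at hlog
  push_cast at hlog
  linarith

theorem sum_log_nomial_sub_le_log_numTables_clone {h : ℕ} (hh : 0 < h)
    {c : Matrix (Fin m) (Fin n) ℕ} (hc : ∀ i j, 0 < nomial κ h (c i j))
    (hR : ∀ i, ∑ j, c i j = h * R i) (hC : ∀ j, ∑ i, c i j = h * C j) :
    (h ^ 2 : ℝ) ^ 2 * ∑ i, ∑ j,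
        (Real.log (nomial κ h (c i j)) / h - Real.log (h * c i j + 1) / h) ≤
      Real.log (numTables κ (clone (h ^ 2) R) (clone (h ^ 2) C)) := by
  set T : Fin m → Fin n → ℕ := fun i j =>
    cardTables κ (fun _ : Fin h × Fin h => h * c i j) (fun _ : Fin h × Fin h => h * c i j)
  have hT (i j) : 0 < T i j := cardTables_square_pos hh (hc i j)
  have hT0 (i j) : (T i j : ℝ) ≠ 0 := by exact_mod_cast (hT i j).ne'
  have hprod : ∏ i, ∏ j, T i j ≤ numTables κ (clone (h ^ 2) R) (clone (h ^ 2) C) :=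
    prod_cardTables_le_numTables_clone hR hC
  calc _ = ∑ i, ∑ j, (h : ℝ) ^ 3 *
        (Real.log (nomial κ h (c i j)) - Real.log (h * c i j + 1)) := by
        simp only [Finset.mul_sum]
        refine Finset.sum_congr rfl fun i _ => Finset.sum_congr rfl fun j _ => ?_
        field_simp
    _ ≤ ∑ i, ∑ j, Real.log (T i j) :=
        Finset.sum_le_sum fun i _ => Finset.sum_le_sum fun j _ =>
          mul_log_nomial_sub_le_log_cardTables hh (hc i j)
    _ = Real.log (∏ i, ∏ j, T i j : ℕ) := by
        push_cast
        rw [Real.log_prod fun i _ => Finset.prod_ne_zero_iff.2 fun j _ => hT0 i j]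
        exact Finset.sum_congr rfl fun i _ => (Real.log_prod fun j _ => hT0 i j).symm
    _ ≤ _ := Real.log_le_log (Nat.cast_pos.2 (Finset.prod_pos fun i _ =>
        Finset.prod_pos fun j _ => hT i j)) (by exact_mod_cast hprod)

theorem tendsto_log_mul_sq_add_one_div {c : ℝ} (hc : 0 ≤ c) :
    Tendsto (fun t : ℕ => Real.log (c * t ^ 2 + 1) / t) atTop (𝓝 0) := by
  have hupper := (tendsto_log_mul_add_one_div (add_nonneg hc zero_le_one)).const_mul 2
  rw [mul_zero] at hupper
  refine squeeze_zero (fun t => ?_) (fun t => ?_) hupper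
  · exact div_nonneg (Real.log_nonneg (le_add_of_nonneg_left (by positivity))) t.cast_nonneg
  · have hle : c * t ^ 2 + 1 ≤ ((c + 1) * t + 1) ^ 2 := by
      have : 0 ≤ (c ^ 2 + c + 1) * t ^ 2 + 2 * (c + 1) * t := by positivity
      linarith
    rw [← mul_div_assoc]
    gcongr
    exact (Real.log_le_log (by positivity) hle).trans_eq (by rw [Real.log_pow, Nat.cast_two])

theorem tendsto_log_nomial_sub_log_div {d v : ℕ} (hd : 0 < d) (h : 0 < nomial κ d v) :
    Tendsto (fun t : ℕ => Real.log (nomial κ (t * d) (t * v)) / (t * d : ℕ) -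
      Real.log ((t * d : ℕ) * (t * v : ℕ) + 1) / (t * d : ℕ)) atTop (𝓝 (Hmax κ (v / d))) := by
  have hd0 : (d : ℝ) ≠ 0 := by exact_mod_cast hd.ne'
  have hlim := ((tendsto_log_nomial_mul h).sub (tendsto_log_mul_sq_add_one_div
    (c := d * v) (by positivity))).div_const (d : ℝ)
  rw [sub_zero, mul_div_cancel_left₀ _ hd0] at hlim
  refine hlim.congr fun t => ?_
  push_cast
  rw [sub_div, div_div, div_div]
  ring_nf

theorem exists_natMatrix_div_eq {W : Matrix (Fin m) (Fin n) ℚ}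
    (hW : W.map (↑) ∈ polytope κ R C) :
    ∃ d : ℕ, 0 < d ∧ ∃ V : Matrix (Fin m) (Fin n) ℕ, (∀ i j, (V i j / d : ℝ) = W i j) ∧
      (∀ i, ∑ j, V i j = d * R i) ∧ ∀ j, ∑ i, V i j = d * C j := by
  obtain ⟨d, hd, hV⟩ := exists_natCast_eq_mul (x := fun p : Fin m × Fin n => W p.1 p.2)
    fun p => by simpa using hW.1 p.1 p.2
  choose V hV using hV
  have hVW (i j) : (V (i, j) : ℝ) = d * W i j := by exact_mod_cast hV (i, j)
  refine ⟨d, hd, fun i j => V (i, j), fun i j => ?_, fun i => ?_, fun j => ?_⟩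
  · rw [hVW, mul_div_cancel_left₀ _ (by exact_mod_cast hd.ne')]
  · have : ∑ j, (V (i, j) : ℝ) = d * R i := by
      simp only [hVW, ← Finset.mul_sum, ← hW.2.2.1 i, Matrix.map_apply]
    exact_mod_cast this
  · have : ∑ i, (V (i, j) : ℝ) = d * C j := by
      simp only [hVW, ← Finset.mul_sum, ← hW.2.2.2 j, Matrix.map_apply]
    exact_mod_cast this

theorem exists_lt_log_numTables_clone {W : Matrix (Fin m) (Fin n) ℚ}
    (hW : W.map (↑) ∈ polytope κ R C) {a : ℝ} (ha : a < ∑ i, ∑ j, Hmax κ (W i j)) :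
    ∃ s : ℕ, 0 < s ∧ a * s ^ 2 < Real.log (numTables κ (clone s R) (clone s C)) := by
  obtain ⟨d, hd, V, hdiv, hR, hC⟩ := exists_natMatrix_div_eq hW
  have hpos (i j) : 0 < nomial κ d (V i j) :=
    nomial_pos_of_div_mem_meanRange hd (hdiv i j ▸ (mem_polytope_iff.1 hW).1 i j)
  have hlim := tendsto_finsetSum Finset.univ fun i _ => tendsto_finsetSum Finset.univ fun j _ =>
    tendsto_log_nomial_sub_log_div hd (hpos i j)
  simp only [hdiv] at hlim
  obtain ⟨t, hat, ht⟩ := ((hlim.eventually_const_lt ha).and (eventually_gt_atTop 0)).exists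
  have htd : 0 < t * d := Nat.mul_pos ht hd
  refine ⟨(t * d) ^ 2, pow_pos htd 2, lt_of_lt_of_le ?_
    (sum_log_nomial_sub_le_log_numTables_clone htd (c := fun i j => t * V i j)
      (fun i j => nomial_mul_pos (hpos i j) t) (fun i => by rw [← Finset.mul_sum, hR, mul_assoc])
      fun j => by rw [← Finset.mul_sum, hC, mul_assoc])⟩
  rw [mul_comm, Nat.cast_pow]
  have : (0 : ℝ) < (t * d : ℕ) := by exact_mod_cast htd
  gcongr

theorem tendsto_div_sq_of_sq_mul_le {u : ℕ → ℝ} {M : ℝ}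
    (hu : ∀ k s r : ℕ, (k : ℝ) ^ 2 * u s ≤ u (k * s + r)) (hle : ∀ s, 0 < s → u s ≤ s ^ 2 * M)
    (hlt : ∀ a < M, ∃ s : ℕ, 0 < s ∧ a * s ^ 2 < u s) :
    Tendsto (fun s : ℕ => 1 / (s : ℝ) ^ 2 * u s) atTop (𝓝 M) := by
  simp only [one_div_mul_eq_div]
  refine tendsto_order.2 ⟨fun a ha => ?_, fun a ha => ?_⟩
  · obtain ⟨s, hs, has⟩ := hlt a ha
    have : (0 : ℝ) < s := by exact_mod_cast hs
    have hlim : Tendsto (fun t : ℕ => ((t / s : ℕ) / t : ℝ) ^ 2 * u s) atTop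
        (𝓝 ((1 / s) ^ 2 * u s)) := by
      refine Tendsto.mul_const _ (Tendsto.pow ?_ 2)
      have h := (tendsto_nat_floor_mul_div_atTop (R := ℝ) (a := 1 / s) (by positivity)).comp
        tendsto_natCast_atTop_atTop
      simpa only [Function.comp_def, one_div_mul_eq_div, Nat.floor_div_eq_div] using h
    have hau : a < (1 / s) ^ 2 * u s := by
      rwa [one_div, inv_pow, inv_mul_eq_div, lt_div_iff₀ (by positivity)]
    filter_upwards [hlim.eventually_const_lt hau] with t ht
    refine ht.trans_le ?_
    rw [div_pow, div_mul_eq_mul_div]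
    gcongr
    simpa only [Nat.div_add_mod'] using hu (t / s) s (t % s)
  · filter_upwards [eventually_gt_atTop 0] with s hs
    have : (0 : ℝ) < s := by exact_mod_cast hs
    exact ((div_le_iff₀' (by positivity)).2 (hle s hs)).trans_lt ha

theorem sq_mul_log_numTables_clone_le (hT : 0 < numTables κ R C) (k s r : ℕ) :
    (k : ℝ) ^ 2 * Real.log (numTables κ (clone s R) (clone s C)) ≤
      Real.log (numTables κ (clone (k * s + r) R) (clone (k * s + r) C)) := by
  have hle := (numTables_clone_pow_le R C k s).trans (numTables_clone_le_add hT (k * s) r)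
  have hpos := numTables_clone_pos hT s
  rw [← Nat.cast_pow, ← Real.log_pow]
  exact Real.log_le_log (by positivity) (by exact_mod_cast hle)

theorem exists_isGreatest_tendsto_log_numTables (hT : 0 < numTables κ R C) :
    ∃ M : ℝ, IsGreatest ((fun Z : Matrix (Fin m) (Fin n) ℝ => ∑ i, ∑ j, Hmax κ (Z i j)) ''
        polytope κ R C) M ∧
      Tendsto (fun s : ℕ => 1 / (s : ℝ) ^ 2 *
        Real.log (numTables κ (clone s R) (clone s C) : ℝ)) atTop (𝓝 M) := by
  have hcont := continuousOn_sum_Hmax κ R C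
  obtain ⟨M, hM⟩ := ((isCompact_polytope κ R C).image_of_continuousOn hcont).exists_isGreatest
    ((polytope_nonempty hT).image _)
  refine ⟨M, hM, tendsto_div_sq_of_sq_mul_le (sq_mul_log_numTables_clone_le hT)
    (fun s hs => ?_) fun a ha => ?_⟩
  · obtain ⟨Z, hZ, hle⟩ := exists_log_numTables_clone_le hT hs
    have := hM.2 ⟨Z, hZ, rfl⟩
    exact hle.trans (by gcongr)
  · obtain ⟨Z, hZ, rfl⟩ := hM.1
    have hev := eventually_nhdsWithin_iff.1 ((hcont Z hZ).eventually_const_lt ha)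
    obtain ⟨Y, ⟨hY, W, rfl⟩, haY⟩ := ((mem_closure_iff_frequently.1
      (mem_closure_rat_polytope hZ)).and_eventually hev).exists
    exact exists_lt_log_numTables_clone hY (haY hY)

end Clones

/-! ### Asymptotics of the independence heuristic -/

section IndepHeuristic

variable {m n : ℕ} {κ : ℕ∞} {R : Fin m → ℕ} {C : Fin n → ℕ}

theorem nomial_row_pos (hT : 0 < numTables κ R C) (i : Fin m) : 0 < nomial κ n (R i) := by
  obtain ⟨A, hAκ, hAR, -⟩ := (Set.ncard_pos (finite_tables κ R C)).1 hT
  rw [← Fintype.card_fin n, nomial_pos_iff]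
  exact ⟨A i, hAκ i, hAR i⟩

theorem nomial_col_pos (hT : 0 < numTables κ R C) (j : Fin n) : 0 < nomial κ m (C j) := by
  obtain ⟨A, hAκ, -, hAC⟩ := (Set.ncard_pos (finite_tables κ R C)).1 hT
  rw [← Fintype.card_fin m, nomial_pos_iff]
  exact ⟨fun i => A i j, fun i => hAκ i j, hAC j⟩

theorem nomial_total_pos (hT : 0 < numTables κ R C) : 0 < nomial κ (m * n) (∑ i, R i) := by
  obtain ⟨A, hAκ, hAR, -⟩ := (Set.ncard_pos (finite_tables κ R C)).1 hT
  have hcard : Fintype.card (Fin m × Fin n) = m * n := by simp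
  rw [← hcard, nomial_pos_iff]
  exact ⟨fun p => A p.1 p.2, fun p => hAκ p.1 p.2, by simp only [Fintype.sum_prod_type, hAR]⟩

theorem sum_clone {M : Type*} [AddCommMonoid M] (s : ℕ) (R : Fin m → ℕ) (f : ℕ → M) :
    ∑ a, f (clone s R a) = s • ∑ i, f (s * R i) := by
  have hmod (p : Fin s × Fin m) : (finProdFinEquiv p).modNat = p.2 :=
    congrArg Prod.snd (finProdFinEquiv.symm_apply_apply p)
  rw [← finProdFinEquiv.sum_comp, Fintype.sum_prod_type]
  simp only [clone, hmod, Finset.sum_const, Finset.card_univ, Fintype.card_fin]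

theorem log_indepHeuristic (hT : 0 < numTables κ R C) :
    Real.log (indepHeuristic κ R C) = -Real.log (nomial κ (m * n) (∑ i, R i)) +
      ∑ i, Real.log (nomial κ n (R i)) + ∑ j, Real.log (nomial κ m (C j)) := by
  have hN : (nomial κ (m * n) (∑ i, R i) : ℝ)⁻¹ ≠ 0 :=
    inv_ne_zero (by exact_mod_cast (nomial_total_pos hT).ne')
  have hrow (i) : (nomial κ n (R i) : ℝ) ≠ 0 := by exact_mod_cast (nomial_row_pos hT i).ne'
  have hcol (j) : (nomial κ m (C j) : ℝ) ≠ 0 := by exact_mod_cast (nomial_col_pos hT j).ne'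
  have hrows := Finset.prod_ne_zero_iff.2 fun i (_ : i ∈ Finset.univ) => hrow i
  have hcols := Finset.prod_ne_zero_iff.2 fun j (_ : j ∈ Finset.univ) => hcol j
  rw [indepHeuristic, Real.log_mul (mul_ne_zero hN hrows) hcols, Real.log_mul hN hrows,
    Real.log_inv, Real.log_prod fun i _ => hrow i, Real.log_prod fun j _ => hcol j]

theorem tendsto_log_indepHeuristic_clone (hT : 0 < numTables κ R C) :
    Tendsto (fun s : ℕ => 1 / (s : ℝ) ^ 2 *
        Real.log (indepHeuristic κ (clone s R) (clone s C))) atTop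
      (𝓝 (-((m : ℝ) * n * Hmax κ ((∑ i, R i : ℕ) / (m * n)))
        + n * ∑ i, Hmax κ ((R i : ℝ) / n)
        + m * ∑ j, Hmax κ ((C j : ℝ) / m))) := by
  have hN := (tendsto_log_nomial_mul (nomial_total_pos hT)).comp (tendsto_pow_atTop two_ne_zero)
  have hR := tendsto_finsetSum Finset.univ fun i _ =>
    tendsto_log_nomial_mul (nomial_row_pos hT i)
  have hC := tendsto_finsetSum Finset.univ fun j _ =>
    tendsto_log_nomial_mul (nomial_col_pos hT j)
  simp only [← Finset.mul_sum] at hR hC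
  have hlim := (hN.neg.add hR).add hC
  rw [Nat.cast_mul] at hlim
  refine hlim.congr' ?_
  filter_upwards [eventually_gt_atTop 0] with s hs
  have : (0 : ℝ) < s := by exact_mod_cast hs
  have hsum : ∑ a, clone s R a = s ^ 2 * ∑ i, R i := by
    have h := sum_clone s R fun x => x
    rwa [← Finset.mul_sum, smul_eq_mul, ← mul_assoc, ← sq] at h
  rw [log_indepHeuristic (numTables_clone_pos hT s), hsum,
    show s * m * (s * n) = s ^ 2 * (m * n) by ring,
    sum_clone s R fun x => Real.log (nomial κ (s * n) x),
    sum_clone s C fun x => Real.log (nomial κ (s * m) x)]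
  simp only [Function.comp_apply, ← Finset.sum_div, nsmul_eq_mul, Nat.cast_pow]
  field_simp

end IndepHeuristic

end CTable

end

theorem theorem3 (m n N : ℕ) (R : Fin m → ℕ) (C : Fin n → ℕ) (κ : ℕ∞) (hκ : 0 < κ)
    (hR : ∑ i, R i = N) (hC : ∑ j, C j = N) (hT : 0 < CTable.numTables κ R C) :
    (∃ M : ℝ,
      IsGreatest ((fun Z : Matrix (Fin m) (Fin n) ℝ => ∑ i, ∑ j, CTable.Hmax κ (Z i j)) ''
        CTable.polytope κ R C) M ∧
      Tendsto (fun s : ℕ => 1 / (s : ℝ) ^ 2 *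
        Real.log (CTable.numTables κ (CTable.clone s R) (CTable.clone s C) : ℝ)) atTop (𝓝 M)) ∧
    Tendsto (fun s : ℕ => 1 / (s : ℝ) ^ 2 *
        Real.log (CTable.indepHeuristic κ (CTable.clone s R) (CTable.clone s C))) atTop
      (𝓝 (-((m : ℝ) * n * CTable.Hmax κ ((N : ℝ) / (m * n)))
        + n * ∑ i, CTable.Hmax κ ((R i : ℝ) / n)
        + m * ∑ j, CTable.Hmax κ ((C j : ℝ) / m))) := by
  subst hR
  exact ⟨CTable.exists_isGreatest_tendsto_log_numTables hT,
    CTable.tendsto_log_indepHeuristic_clone hT⟩
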